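/- **Setting.** Let $(\mathsf D,\mathfrak m)$ be a finite measure space and $\mathbb H=L^2(\mathsf D,\mathfrak m)$, with norm $|\cdot|$ and scalar product $\langle\cdot,\cdot\rangle$. Let $\mathbb V$ be a Hilbert space densely and compactly embedded in $\mathbb H$, and let $\mathcal E:\mathbb V\times\mathbb V\to\mathbb R$ be a symmetric bilinear form with $\mathcal E(u,u)\ge\alpha|u|^2$ and $M^{-1}\|u\|_{\mathbb V}^2\le \mathcal E(u,u)+|u|^2\le M\|u\|_{\mathbb V}^2$ for all $u\in\mathbb V$, where $\alpha\ge 0$, $M>0$. Let $\mathscr K:\mathbb H\to(-\infty,+\infty]$ be lower semicontinuous, not identically $+\infty$, and such that $\mathscr K_\theta(V):=\mathscr K(V)+\frac\theta2|V|^2$ is convex for a given $\theta\ge0$. Let $\mathbb K=\{V:\mathscr K(V)<+\infty\}$, and assume that every $V\in\mathbb K$ satisfies $V\ge V_{\min}$ $\mathfrak m$-a.e., for a fixed $V_{\min}\in\mathbb R$. Put $\mathbb K[c]=\{V\in\mathbb K: |V|\le c,\ \mathscr K_\theta(V)\le c\}$ and $\lambda_{\min}=\alpha+V_{\min}$. For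 $V\in\mathbb K$ let $D(\mathcal E_V)=\{u\in\mathbb V:\int V_+u^2\,d\mathfrak m<\infty\}$ and $\mathcal E_V(u,v)=\mathcal E(u,v)+\int Vuv\,d\mathfrak m$. A $(V,\lambda)$-eigenfunction is a nonzero $u\in D(\mathcal E_V)$ with $\mathcal E_V(u,v)=\lambda\langle u,v\rangle$ for all $v\in D(\mathcal E_V)$; it is normalized if $|u|=1$. Let $\lambda_1(V)\le\lambda_2(V)\le\cdots$ be the eigenvalues, counted with multiplicity, $$\lambda_k(V)=\min_{F\subset D(\mathcal E_V),\ \dim F=k}\ \max_{u\in F\setminus\{0\}}\frac{\mathcal E_V(u,u)}{|u|^2},$$ let $\boldsymbol\lambda^J(V)=(\lambda_1(V),\dots,\lambda_J(V))$, and let $\boldsymbol U^J(V)$ be the set of $(u_1,\dots,u_J)$ that are orthonormal in $\mathbb H$ and such that each $u_i$ is a $(V,\lambda_i(V))$-eigenfunction. Assume that all $(V,\lambda)$-eigenfunctions with $V\in\mathbb K$ belong to $L^4(\mathsf D,\mathfrak m)$, and that for all $c$ and all $\bar\lambda>\lambda_{\min}$ the set of normalized $(V,\lambda)$-eigenfunctions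 with $V\in\mathbb K[c]$ and $\lambda\le\bar\lambda$ is relatively compact in $L^4(\mathsf D,\mathfrak m)$. Let $J\ge1$, $\Lambda^J=\{\boldsymbol\lambda\in\mathbb R^J:\lambda_{\min}\le\lambda_1\le\dots\le\lambda_J\}$, and let $\varphi:\Lambda^J\to\mathbb R$ be of class $C^1$ and such that, for every $\boldsymbol\lambda\in\Lambda^J$, $\partial_J\varphi(\boldsymbol\lambda)\ge0$, and $\partial_{k-1}\varphi(\boldsymbol\lambda)\ge\partial_k\varphi(\boldsymbol\lambda)$ whenever $2\le k\le J$ and $\lambda_{k-1}=\lambda_k$. Put $\mathscr H(V)=\varphi(\boldsymbol\lambda^J(V))$ for $V\in\mathbb K$. For $c$ with $\mathbb K[c]\neq\emptyset$ let $\boldsymbol{\mathrm U}^J[c]=\bigcup_{V\in\mathbb K[c]}\boldsymbol U^J(V)$, $\ell_J(c)=\sup_{V\in\mathbb K[c]}\lambda_J(V)$, and, for every $V\in\mathbb H$ and $1\le k\le J$, $$\sigma_{k,c}(V)=\min\Big\{\sum_{h=1}^k\Big(\mathcal E(w_h,w_h)+\int Vw_h^2\,d\mathfrak m\Big):\boldsymbol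 w\in\boldsymbol{\mathrm U}^J[c]\Big\}.$$ Let $\varphi_c:\mathbb R^J\to\mathbb R$ be any $C^1$ and Lipschitz function which coincides with $\varphi$ on $\Lambda^J\cap[\lambda_{\min},1+\ell_J(c)]^J$, and put, for $V\in\mathbb H$, $$\mathscr H_c(V)=\varphi_c\big(\sigma_{1,c}(V),\ \sigma_{2,c}(V)-\sigma_{1,c}(V),\ \dots,\ \sigma_{J,c}(V)-\sigma_{J-1,c}(V)\big).$$ **Theorem (superdifferentiability of $\mathscr H$).** Let $V\in\mathbb K[c]$ and $\boldsymbol u=(u_1,\dots,u_J)\in\boldsymbol U^J(V)$. Then $\xi=\sum_{i=1}^J\partial_i\varphi(\boldsymbol\lambda^J(V))\,u_i^2$ belongs to $\mathbb H$ and to the Fréchet superdifferential of $\mathscr H_c$ at $V$, that is, $$\limsup_{W\to V}\frac{\mathscr H_c(W)-\mathscr H_c(V)-\langle\xi,W-V\rangle}{|W-V|}\le0 .$$ Moreover there are $\varrho>0$ and a convex function $\omega:\mathbb H\to[0,+\infty)$ of class $C^1$ with $\omega(0)=0$ such that $$\mathscr H(W)-\mathscr H(V)-\langle\xi,W-V\rangle\le\omega(W-V)\qquad\text{for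 every }W\in\mathbb K[c]\text{ with }|W-V|<\varrho .$$ -/

import Mathlib

open MeasureTheory Filter Topology Set
open scoped ENNReal NNReal RealInnerProductSpace

noncomputable section

namespace SchrodingerSpectral

instance fact_one_le_four : Fact ((1 : ℝ≥0∞) ≤ 4) := ⟨by norm_num⟩

section Forms

/- `Lp ℝ 2 m` is the Hilbert space `ℍ = L²(D, m)`; `ι : 𝕍 →L[ℝ] Lp ℝ 2 m` is the embedding of the
form domain `𝕍` into `ℍ`, and `E` is the bilinear form on `𝕍`. -/
variable {D : Type*} [MeasurableSpace D] {m : Measure D}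
  {𝕍 : Type*} [NormedAddCommGroup 𝕍] [InnerProductSpace ℝ 𝕍]
  (ι : 𝕍 →L[ℝ] Lp ℝ 2 m) (E : 𝕍 →L[ℝ] 𝕍 →L[ℝ] ℝ)

/-- The standing assumptions on the embedding `𝕍 ↪ L²(D, m)` (injective, dense, compact) and on the
symmetric coercive form `E`, with constants `α ≥ 0` and `M > 0`. -/
structure IsCoerciveForm (α M : ℝ) : Prop where
  injective : Function.Injective ι
  denseRange : DenseRange ι
  compact : IsCompactOperator ι
  symm : ∀ u v, E u v = E v u
  alpha_nonneg : 0 ≤ α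
  M_pos : 0 < M
  lower : ∀ u, α * ‖ι u‖ ^ 2 ≤ E u u
  coercive : ∀ u, M⁻¹ * ‖u‖ ^ 2 ≤ E u u + ‖ι u‖ ^ 2
  bounded : ∀ u, E u u + ‖ι u‖ ^ 2 ≤ M * ‖u‖ ^ 2

/-- The domain `D(E_V) = {u ∈ 𝕍 : ∫ V₊ u² dm < ∞}`. -/
def formDomain (V : Lp ℝ 2 m) : Set 𝕍 :=
  {u | Integrable (fun x => max (V x) 0 * (ι u x) ^ 2) m}

/-- The form `E_V(u, v) = E(u, v) + ∫ V u v dm`. -/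
def schrodingerForm (V : Lp ℝ 2 m) (u v : 𝕍) : ℝ :=
  E u v + ∫ x, V x * (ι u x * ι v x) ∂m

/-- `u` is a `(V, lam)`-eigenfunction. -/
def IsEigenfunction (V : Lp ℝ 2 m) (lam : ℝ) (u : 𝕍) : Prop :=
  u ∈ formDomain ι V ∧ u ≠ 0 ∧
    ∀ v ∈ formDomain ι V, schrodingerForm ι E V u v = lam * ⟪ι u, ι v⟫

/-- `u` is a normalized `(V, lam)`-eigenfunction. -/
def IsNormalizedEigenfunction (V : Lp ℝ 2 m) (lam : ℝ) (u : 𝕍) : Prop :=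
  IsEigenfunction ι E V lam u ∧ ‖ι u‖ = 1

/-- The `k`-th eigenvalue `λ_k(V)`, `k = 1, 2, …`, counted with multiplicity, through the min-max
principle: the minimum over the `k`-dimensional subspaces `F ⊆ D(E_V)` of the maximum over
`u ∈ F \ {0}` of `E_V(u, u) / ∫ u² dm`. -/
def eigenvalue (V : Lp ℝ 2 m) (k : ℕ) : ℝ :=
  sInf {r : ℝ | ∃ F : Submodule ℝ 𝕍, (F : Set 𝕍) ⊆ formDomain ι V ∧ Module.finrank ℝ F = k ∧
    r = sSup {q : ℝ | ∃ u ∈ F, u ≠ 0 ∧ q = schrodingerForm ι E V u u / ‖ι u‖ ^ 2}}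

/-- The vector `(λ_1(V), …, λ_J(V))`; the entry with index `i : Fin J` is `λ_{i+1}(V)`. -/
def eigenvalueVec (J : ℕ) (V : Lp ℝ 2 m) : Fin J → ℝ :=
  fun i => eigenvalue ι E V (i + 1)

/-- `U^J(V)`: orthonormal systems `(u_1, …, u_J)` of eigenfunctions associated to
`(λ_1(V), …, λ_J(V))`. -/
def eigenSystems (J : ℕ) (V : Lp ℝ 2 m) : Set (Fin J → 𝕍) :=
  {u | (∀ i, IsNormalizedEigenfunction ι E V (eigenvalueVec ι E J V i) (u i)) ∧
    ∀ i j, i ≠ j → ⟪ι (u i), ι (u j)⟫ = 0}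

end Forms

section Potentials

variable {D : Type*} [MeasurableSpace D] {m : Measure D}

/-- `𝒦_θ(V) = 𝒦(V) + (θ/2)|V|²`. -/
def shifted (𝒦 : Lp ℝ 2 m → EReal) (θ : ℝ) (V : Lp ℝ 2 m) : EReal :=
  𝒦 V + ((θ / 2 * ‖V‖ ^ 2 : ℝ) : EReal)

/-- The proper domain `𝕂 = {𝒦 < +∞}`: the admissible potentials. -/
def admissible (𝒦 : Lp ℝ 2 m → EReal) : Set (Lp ℝ 2 m) := {V | 𝒦 V < ⊤}

/-- The standing assumptions on `𝒦 : L²(D, m) → (-∞, +∞]`: it is lower semicontinuous and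
`-θ`-convex, with `θ ≥ 0`, and potentials in its proper domain are bounded below by `Vmin`. -/
structure IsPotentialFunctional (𝒦 : Lp ℝ 2 m → EReal) (θ Vmin : ℝ) : Prop where
  ne_bot : ∀ V, 𝒦 V ≠ ⊥
  proper : (admissible 𝒦).Nonempty
  lsc : LowerSemicontinuous 𝒦
  theta_nonneg : 0 ≤ θ
  convex : ∀ V W : Lp ℝ 2 m, ∀ a b : ℝ, 0 < a → 0 < b → a + b = 1 →
    shifted 𝒦 θ (a • V + b • W) ≤ (a : EReal) * shifted 𝒦 θ V + (b : EReal) * shifted 𝒦 θ W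
  lower_bound : ∀ V ∈ admissible 𝒦, ∀ᵐ x ∂m, Vmin ≤ V x

/-- `𝕂[c] = {V ∈ 𝕂 : |V| ≤ c, 𝒦_θ(V) ≤ c}`. -/
def admissibleLevel (𝒦 : Lp ℝ 2 m → EReal) (θ c : ℝ) : Set (Lp ℝ 2 m) :=
  {V | V ∈ admissible 𝒦 ∧ ‖V‖ ≤ c ∧ shifted 𝒦 θ V ≤ (c : EReal)}

end Potentials

section Functionals

variable {D : Type*} [MeasurableSpace D] {m : Measure D}
  {𝕍 : Type*} [NormedAddCommGroup 𝕍] [InnerProductSpace ℝ 𝕍]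
  (ι : 𝕍 →L[ℝ] Lp ℝ 2 m) (E : 𝕍 →L[ℝ] 𝕍 →L[ℝ] ℝ)
  (𝒦 : Lp ℝ 2 m → EReal) (θ : ℝ)

/-- The `L⁴` assumption: eigenfunctions of admissible potentials are in `L⁴(D, m)`, and, for all
`c` and all `lamBar > lamMin`, the set of normalized `(V, lam)`-eigenfunctions with `V ∈ 𝕂[c]` and
`lam ≤ lamBar` is relatively compact in `L⁴(D, m)`. -/
structure EigenfunctionsL4 (lamMin : ℝ) : Prop where
  memLp : ∀ V ∈ admissible 𝒦, ∀ lam u, IsEigenfunction ι E V lam u → MemLp (ι u) 4 m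
  relCompact : ∀ c lamBar : ℝ, lamMin < lamBar →
    IsCompact (closure {f : Lp ℝ 4 m | ∃ V ∈ admissibleLevel 𝒦 θ c, ∃ lam ≤ lamBar, ∃ u,
      IsNormalizedEigenfunction ι E V lam u ∧ f =ᵐ[m] ι u})

/-- `Λ^J`: vectors with `lamMin ≤ λ_1 ≤ ⋯ ≤ λ_J`. -/
def orderedVectors (J : ℕ) (lamMin : ℝ) : Set (Fin J → ℝ) :=
  {l | (∀ i, lamMin ≤ l i) ∧ Monotone l}

/-- The partial derivative `∂_i φ` on `Λ^J`; since `Λ^J` is convex with nonempty interior, the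
derivative within `Λ^J` is uniquely determined, also at boundary points. -/
def partialDeriv {J : ℕ} (lamMin : ℝ) (φ : (Fin J → ℝ) → ℝ) (i : Fin J) (l : Fin J → ℝ) : ℝ :=
  fderivWithin ℝ φ (orderedVectors J lamMin) l (Pi.single i 1)

/-- The structural condition: `∂_J φ ≥ 0`, and `∂_{k-1} φ ≥ ∂_k φ` where `λ_{k-1} = λ_k`. -/
def StructuralCondition {J : ℕ} (lamMin : ℝ) (φ : (Fin J → ℝ) → ℝ) : Prop :=
  ∀ l ∈ orderedVectors J lamMin,
    (∀ i : Fin J, (i : ℕ) + 1 = J → 0 ≤ partialDeriv lamMin φ i l) ∧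
    ∀ i j : Fin J, (i : ℕ) + 1 = j → l i = l j →
      partialDeriv lamMin φ j l ≤ partialDeriv lamMin φ i l

/-- `ℋ(V) = φ(λ_1(V), …, λ_J(V))`. -/
def spectralFunctional {J : ℕ} (φ : (Fin J → ℝ) → ℝ) (V : Lp ℝ 2 m) : ℝ :=
  φ (eigenvalueVec ι E J V)

/-- `𝐔^J[c]`, the union of the sets `U^J(V)` over `V ∈ 𝕂[c]`. -/
def eigenSystemsLevel (J : ℕ) (c : ℝ) : Set (Fin J → 𝕍) :=
  {w | ∃ V ∈ admissibleLevel 𝒦 θ c, w ∈ eigenSystems ι E J V}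

/-- `ℓ_J(c)`, the supremum of `λ_J(V)` over `V ∈ 𝕂[c]`. -/
def maxEigenvalue (J : ℕ) (c : ℝ) : ℝ :=
  sSup ((fun V => eigenvalue ι E V J) '' admissibleLevel 𝒦 θ c)

/-- `σ_{k,c}(V) = min { ∑_{h=1}^k (E(w_h, w_h) + ∫ V w_h² dm) : w ∈ 𝐔^J[c] }`, for `V ∈ L²(D, m)`
and `k = i + 1`. -/
def sigmaLevel (J : ℕ) (c : ℝ) (i : Fin J) (V : Lp ℝ 2 m) : ℝ :=
  sInf ((fun w : Fin J → 𝕍 => ∑ h ∈ Finset.Iic i, schrodingerForm ι E V (w h) (w h)) ''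
    eigenSystemsLevel ι E 𝒦 θ J c)

/-- `(s_1, s_2 - s_1, …, s_J - s_{J-1})`. -/
def increments {J : ℕ} (s : Fin J → ℝ) : Fin J → ℝ :=
  fun i => if (i : ℕ) = 0 then s i else s i - s ⟨i - 1, by omega⟩

/-- `φc` is an admissible choice of `φ_c`: a `C¹` and Lipschitz function on `ℝ^J` which coincides
with `φ` on `Λ^J ∩ [lamMin, 1 + ℓ_J(c)]^J`. -/
def IsLevelExtension {J : ℕ} (lamMin c : ℝ) (φ φc : (Fin J → ℝ) → ℝ) : Prop :=
  ContDiff ℝ 1 φc ∧ (∃ L : ℝ≥0, LipschitzWith L φc) ∧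
    ∀ l ∈ orderedVectors J lamMin,
      (∀ i, l i ∈ Icc lamMin (1 + maxEigenvalue ι E 𝒦 θ J c)) → φc l = φ l

/-- `ℋ_c(V) = ψ_c(σ_{1,c}(V), …, σ_{J,c}(V))` for `V ∈ L²(D, m)`, where
`ψ_c(s) = φ_c(s_1, s_2 - s_1, …, s_J - s_{J-1})`. -/
def levelFunctional {J : ℕ} (c : ℝ) (φc : (Fin J → ℝ) → ℝ) (V : Lp ℝ 2 m) : ℝ :=
  φc (increments fun i => sigmaLevel ι E 𝒦 θ J c i V)

end Functionals

section Subdifferential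

variable {H : Type*} [NormedAddCommGroup H] [InnerProductSpace ℝ H]

/-- Fréchet subdifferential of a real-valued function. The lower limit is taken in `[-∞, +∞]`. -/
def frechetSubdifferential (G : H → ℝ) (v : H) : Set H :=
  {ξ | 0 ≤ liminf (fun w => (((G w - G v - ⟪ξ, w - v⟫) / ‖w - v‖ : ℝ) : EReal)) (𝓝[≠] v)}

/-- Fréchet superdifferential `∂⁺G(v) = -∂⁻(-G)(v)`. -/
def frechetSuperdifferential (G : H → ℝ) (v : H) : Set H :=
  {ξ | -ξ ∈ frechetSubdifferential (fun w => -G w) v}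

/-- Functions `ω : H → [0, +∞)`, convex and of class `C¹`, with `ω(0) = 0`. -/
structure IsBarrier (ω : H → ℝ) : Prop where
  nonneg : ∀ h, 0 ≤ ω h
  contDiff : ContDiff ℝ 1 ω
  convex : ConvexOn ℝ univ ω
  zero : ω 0 = 0

end Subdifferential

end SchrodingerSpectral

end

open SchrodingerSpectral

/-! Single eigenvalues are badly behaved in `V` where they cross, but partial sums are not. By Ky
Fan, `λ_1(V) + ⋯ + λ_k(V)` is the least value of `∑ E_V(w_h, w_h)` over orthonormal families.
Eigenfunctions are in `L⁴`, so those of one potential lie in the form domain of every other, and for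
them this energy is affine in `V`, with slope `q_k(w) = ∑_{h ≤ k} w_h²` in `L²`. Hence `σ_{k,c}` is
an infimum of affine functions with bounded slopes, equals the partial sum of eigenvalues on `𝕂[c]`
(`sigmaLevel_eq_sum`), and has `q_k(u)` as a supergradient at `V`.

Linearizing `φ` and summing by parts, `δσ_k` receives the weight `∂_k φ - ∂_{k+1} φ`, with `∂_{J+1}
φ = 0`. The structural condition makes it nonnegative if `k = J` or `λ_k = λ_{k+1}`, and then the
supergradient inequality suffices. If `λ_k < λ_{k+1}` the sign is unknown, but `σ_{k,c}` is
differentiable at `V`: the Ky Fan inequality has a remainder, proportional to the gap, that forces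
almost minimizers towards the span of `u_1, …, u_k` (`IsEigenSystem.sum_minmax_le`). With `L⁴`
compactness their slopes converge to `q_k(u)` (`tendsto_squareSum`), and a Danskin argument
concludes (`eventually_le_infAffine_sub`). These facts meet in `eventually_comp_sigmaLevel_sub_le`,
used once for `φ_c` on all of `L²` and once for `φ` on `𝕂[c]`. The barrier comes from a general
fact: an `o(‖h‖)` upper bound can be replaced by a convex `C¹` one (`exists_isBarrier`).

The spectral theory is done for an abstract form with compact sublevels, on the image of `D(E_V)`
with the `L²` norm, which need not be complete. -/

namespace SchrodingerSpectral

open Module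

/-! ### Min-max values and the Ky Fan inequality for an abstract quadratic form -/

section MinMax

variable {X : Type*} [NormedAddCommGroup X] [InnerProductSpace ℝ X]

/-- The `k`-th min-max value of the quadratic form `A x x` relative to the norm of `X`. -/
noncomputable def minmax (A : X →ₗ[ℝ] X →ₗ[ℝ] ℝ) (k : ℕ) : ℝ :=
  sInf {r : ℝ | ∃ F : Submodule ℝ X, finrank ℝ F = k ∧
    r = sSup {q : ℝ | ∃ u ∈ F, u ≠ 0 ∧ q = A u u / ‖u‖ ^ 2}}

/-- Orthonormal systems of eigenvectors realizing the first `n` min-max values. -/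
structure IsEigenSystem (A : X →ₗ[ℝ] X →ₗ[ℝ] ℝ) {n : ℕ} (u : Fin n → X) : Prop where
  orthonormal : Orthonormal ℝ u
  eigen : ∀ i v, A (u i) v = minmax A (i + 1) * ⟪u i, v⟫

variable {A : X →ₗ[ℝ] X →ₗ[ℝ] ℝ} {b : ℝ}

/-- Expansion in an orthonormal basis, whose coefficients are at most `‖u‖`. It keeps the inner
`sSup` of `minmax` away from its default value. Positive `finrank` excludes infinite-dimensional
subspaces, whose `finrank` is `0`. -/
theorem exists_form_le_of_finrank_pos {F : Submodule ℝ X} (hF : 0 < finrank ℝ F) :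
    ∃ C, ∀ u ∈ F, A u u ≤ C * ‖u‖ ^ 2 := by
  have : FiniteDimensional ℝ F := FiniteDimensional.of_finrank_pos hF
  let e := stdOrthonormalBasis ℝ F
  refine ⟨∑ i, ∑ j, |A (e i) (e j)|, fun u hu => ?_⟩
  have hsum : u = ∑ i, ⟪e i, (⟨u, hu⟩ : F)⟫ • (e i : X) := by
    simpa using (congrArg Subtype.val (e.sum_repr' ⟨u, hu⟩)).symm
  have hc : ∀ i, |⟪e i, (⟨u, hu⟩ : F)⟫| ≤ ‖u‖ := fun i => by
    simpa using abs_real_inner_le_norm (e i) (⟨u, hu⟩ : F)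
  conv_lhs => rw [hsum]
  simp only [map_sum, LinearMap.sum_apply, map_smul, LinearMap.smul_apply, smul_eq_mul,
    Finset.sum_mul, Finset.mul_sum]
  rw [Finset.sum_comm]
  refine Finset.sum_le_sum fun i _ => Finset.sum_le_sum fun j _ => ?_
  refine (le_abs_self _).trans ?_
  rw [abs_mul, abs_mul]
  have := hc i
  have := hc j
  nlinarith [mul_le_mul (hc i) (hc j) (abs_nonneg _) (norm_nonneg _), abs_nonneg (A (e i) (e j))]

theorem exists_ne_zero_of_finrank_pos {F : Submodule ℝ X} (hF : 0 < finrank ℝ F) :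
    ∃ u ∈ F, u ≠ 0 := by
  have : Nontrivial F := Module.nontrivial_of_finrank_pos hF
  obtain ⟨x, hx⟩ := exists_ne (0 : F)
  exact ⟨x, x.2, by simpa using hx⟩

theorem le_sSup_quotient {F : Submodule ℝ X} (hF : 0 < finrank ℝ F) {u : X} (hu : u ∈ F)
    (hu0 : u ≠ 0) :
    A u u / ‖u‖ ^ 2 ≤ sSup {q : ℝ | ∃ u ∈ F, u ≠ 0 ∧ q = A u u / ‖u‖ ^ 2} := by
  obtain ⟨C, hC⟩ := exists_form_le_of_finrank_pos (A := A) hF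
  refine le_csSup ⟨C, ?_⟩ ⟨u, hu, hu0, rfl⟩
  rintro _ ⟨v, hv, hv0, rfl⟩
  have := norm_pos_iff.2 hv0
  rw [div_le_iff₀ (by positivity)]
  exact hC v hv

theorem minmax_le (hb : ∀ x, b * ‖x‖ ^ 2 ≤ A x x) {F : Submodule ℝ X} {k : ℕ} (hk : 0 < k)
    (hF : finrank ℝ F = k) {r : ℝ} (hr : ∀ u ∈ F, A u u ≤ r * ‖u‖ ^ 2) : minmax A k ≤ r := by
  refine le_trans (csInf_le (a := sSup {q : ℝ | ∃ u ∈ F, u ≠ 0 ∧ q = A u u / ‖u‖ ^ 2}) ⟨b, ?_⟩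
    ⟨F, hF, rfl⟩) ?_
  · rintro _ ⟨G, hG, rfl⟩
    obtain ⟨x, hx, hx0⟩ := exists_ne_zero_of_finrank_pos (hG ▸ hk)
    refine le_trans ?_ (le_sSup_quotient (hG ▸ hk) hx hx0)
    have := norm_pos_iff.2 hx0
    rw [le_div_iff₀ (by positivity)]
    exact hb x
  · obtain ⟨x, hx, hx0⟩ := exists_ne_zero_of_finrank_pos (hF ▸ hk)
    refine csSup_le ⟨_, x, hx, hx0, rfl⟩ ?_
    rintro _ ⟨v, hv, hv0, rfl⟩
    have := norm_pos_iff.2 hv0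
    rw [div_le_iff₀ (by positivity)]
    exact hr v hv

theorem le_minmax {k : ℕ} (hk : 0 < k) (hex : ∃ F : Submodule ℝ X, finrank ℝ F = k) {r : ℝ}
    (hr : ∀ F : Submodule ℝ X, finrank ℝ F = k → ∃ u ∈ F, u ≠ 0 ∧ r * ‖u‖ ^ 2 ≤ A u u) :
    r ≤ minmax A k := by
  obtain ⟨F, hF⟩ := hex
  refine le_csInf ⟨_, F, hF, rfl⟩ ?_
  rintro _ ⟨G, hG, rfl⟩
  obtain ⟨x, hx, hx0, h⟩ := hr G hG
  refine le_trans ?_ (le_sSup_quotient (hG ▸ hk) hx hx0)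
  have := norm_pos_iff.2 hx0
  rwa [le_div_iff₀ (by positivity)]

theorem form_sum_smul {n : ℕ} (w : Fin n → X) (c : Fin n → ℝ) :
    A (∑ i, c i • w i) (∑ i, c i • w i) = ∑ i, ∑ j, c i * (c j * A (w i) (w j)) := by
  simp only [map_sum, map_smul, LinearMap.sum_apply, LinearMap.smul_apply, smul_eq_mul,
    Finset.mul_sum]
  rw [Finset.sum_comm]
  exact Finset.sum_congr rfl fun i _ => Finset.sum_congr rfl fun j _ => by ring

theorem minmax_le_of_orthonormal (hb : ∀ x, b * ‖x‖ ^ 2 ≤ A x x) {k : ℕ} (hk : 0 < k)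
    {w : Fin k → X} (hw : Orthonormal ℝ w) {ν : Fin k → ℝ}
    (hA : ∀ i j, A (w i) (w j) = if i = j then ν i else 0) {r : ℝ} (hr : ∀ i, ν i ≤ r) :
    minmax A k ≤ r := by
  have hF := finrank_span_eq_card hw.linearIndependent
  rw [Fintype.card_fin] at hF
  refine minmax_le hb hk hF fun x hx => ?_
  obtain ⟨c, rfl⟩ := (Submodule.mem_span_range_iff_exists_fun ℝ).1 hx
  rw [form_sum_smul, ← real_inner_self_eq_norm_sq, hw.inner_sum, Finset.mul_sum]
  refine Finset.sum_le_sum fun i _ => ?_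
  simp only [hA, mul_ite, mul_zero, Finset.sum_ite_eq, Finset.mem_univ, if_true]
  have := mul_le_mul_of_nonneg_left (hr i) (mul_self_nonneg (c i))
  simp only [conj_trivial]
  linarith

theorem orthonormal_snoc {k : ℕ} {u : Fin k → X} (hu : Orthonormal ℝ u) {v : X} (hv : ‖v‖ = 1)
    (huv : ∀ i, ⟪u i, v⟫ = 0) : Orthonormal ℝ (Fin.snoc u v : Fin (k + 1) → X) := by
  rw [orthonormal_iff_ite] at hu ⊢
  intro i j
  induction i using Fin.lastCases with
  | last =>
    induction j using Fin.lastCases with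
    | last => simp [hv]
    | cast j => simpa [(Fin.castSucc_lt_last j).ne', real_inner_comm] using huv j
  | cast i =>
    induction j using Fin.lastCases with
    | last => simp [huv, (Fin.castSucc_lt_last i).ne]
    | cast j => simp [hu]

/-- The test space is the span of the `u i` and `v`, on which `A` is diagonal because `A (u i) v = ν
i * ⟪u i, v⟫ = 0`; its largest diagonal entry is `A v v`. -/
theorem minmax_succ_le (hsymm : ∀ x y, A x y = A y x) (hb : ∀ x, b * ‖x‖ ^ 2 ≤ A x x) {k : ℕ}
    {u : Fin k → X} (hu : Orthonormal ℝ u) {ν : Fin k → ℝ}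
    (hν : ∀ i v, A (u i) v = ν i * ⟪u i, v⟫) {v : X} (hv : ‖v‖ = 1)
    (huv : ∀ i, ⟪u i, v⟫ = 0) (hle : ∀ i, ν i ≤ A v v) : minmax A (k + 1) ≤ A v v := by
  refine minmax_le_of_orthonormal hb k.succ_pos (orthonormal_snoc hu hv huv)
    (ν := Fin.snoc ν (A v v)) (fun i j => ?_) (fun i => ?_)
  · have hu' := orthonormal_iff_ite.1 hu
    induction i using Fin.lastCases with
    | last =>
      induction j using Fin.lastCases with
      | last => simp
      | cast j => simp [hsymm v, hν, huv, (Fin.castSucc_lt_last j).ne']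
    | cast i =>
      induction j using Fin.lastCases with
      | last => simp [hν, huv, (Fin.castSucc_lt_last i).ne]
      | cast j => simp [hν, hu']
  · induction i using Fin.lastCases with
    | last => simp
    | cast i => simpa using hle i

theorem IsEigenSystem.form_self {n : ℕ} {u : Fin n → X} (hu : IsEigenSystem A u) (i : Fin n) :
    A (u i) (u i) = minmax A (i + 1) := by
  rw [hu.eigen, real_inner_self_eq_norm_sq, hu.orthonormal.1]; simp

/-- Adjoining the normalized `v` to the first `k` eigenvectors gives a test space for the value of
index `k + 1`. Strong induction supplies the bound of the earlier values by the energy of `v`. -/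
theorem IsEigenSystem.minmax_mul_le (hsymm : ∀ x y, A x y = A y x)
    (hb : ∀ x, b * ‖x‖ ^ 2 ≤ A x x) {n : ℕ} {u : Fin n → X} (hu : IsEigenSystem A u) (k : ℕ) :
    k ≤ n → ∀ v, (∀ i : Fin n, (i : ℕ) < k → ⟪u i, v⟫ = 0) →
      minmax A (k + 1) * ‖v‖ ^ 2 ≤ A v v := by
  induction k using Nat.strong_induction_on with
  | _ k ih =>
    intro hk v hv
    rcases eq_or_ne v 0 with rfl | hv0
    · simp
    have hvp := norm_pos_iff.2 hv0
    set w := ‖v‖⁻¹ • v with hw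
    have hAw : A w w = A v v / ‖v‖ ^ 2 := by
      simp only [hw, map_smul, LinearMap.smul_apply, smul_eq_mul]; field_simp
    have hw1 : ‖w‖ = 1 := by rw [hw, norm_smul, norm_inv, norm_norm, inv_mul_cancel₀ hvp.ne']
    rw [← le_div_iff₀ (by positivity), ← hAw]
    refine minmax_succ_le hsymm hb (hu.orthonormal.comp _ (Fin.castLE_injective hk))
      (ν := fun i => minmax A (i + 1)) (fun i v => hu.eigen _ v) hw1 (fun i => ?_) fun i => ?_
    · simp [hw, inner_smul_right, hv (Fin.castLE hk i) (by simp)]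
    · have := ih i i.2 (i.2.le.trans hk) w fun j hj => by
        simp [hw, inner_smul_right, hv j (hj.trans i.2)]
      simpa [hw1] using this

theorem IsEigenSystem.minmax_mono (hsymm : ∀ x y, A x y = A y x)
    (hb : ∀ x, b * ‖x‖ ^ 2 ≤ A x x) {n : ℕ} {u : Fin n → X} (hu : IsEigenSystem A u)
    {i j : Fin n} (hij : i ≤ j) : minmax A (i + 1) ≤ minmax A (j + 1) := by
  have := hu.minmax_mul_le hsymm hb i i.2.le (u j) fun l hl =>
    hu.orthonormal.2 (lt_of_lt_of_le (Fin.lt_def.2 hl) hij).ne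
  simpa [hu.form_self, hu.orthonormal.1] using this

theorem IsEigenSystem.le_minmax (hb : ∀ x, b * ‖x‖ ^ 2 ≤ A x x) {n : ℕ} {u : Fin n → X}
    (hu : IsEigenSystem A u) (i : Fin n) : b ≤ minmax A (i + 1) := by
  simpa [hu.form_self, hu.orthonormal.1] using hb (u i)

/-- The Ky Fan inequality with a remainder measuring the distance of the orthonormal family `w`
from the span of the first eigenvectors. -/
theorem IsEigenSystem.sum_minmax_le (hsymm : ∀ x y, A x y = A y x)
    (hb : ∀ x, b * ‖x‖ ^ 2 ≤ A x x) {n : ℕ} {u : Fin n → X} (hu : IsEigenSystem A u) (k : Fin n)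
    {ν : ℝ} (hν : ∀ v, (∀ i ≤ k, ⟪u i, v⟫ = 0) → ν * ‖v‖ ^ 2 ≤ A v v)
    {w : Fin n → X} (hw : Orthonormal ℝ w) :
    ∑ h ∈ Finset.Iic k, minmax A (h + 1) + (ν - minmax A (k + 1)) *
        ∑ h ∈ Finset.Iic k, ‖w h - ∑ i ∈ Finset.Iic k, ⟪u i, w h⟫ • u i‖ ^ 2
      ≤ ∑ h ∈ Finset.Iic k, A (w h) (w h) := by
  set μ : Fin n → ℝ := fun i => minmax A (i + 1) with hμ
  set r : Fin n → X := fun h => w h - ∑ i ∈ Finset.Iic k, ⟪u i, w h⟫ • u i with hr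
  have hur : ∀ h, ∀ i ≤ k, ⟪u i, r h⟫ = 0 := by
    intro h i hi
    simp only [hr, inner_sub_right, inner_sum, inner_smul_right, orthonormal_iff_ite.1
      hu.orthonormal]
    simp [Finset.mem_Iic.2 hi]
  have hww : ∀ h, w h = ∑ i ∈ Finset.Iic k, ⟪u i, w h⟫ • u i + r h := fun h => by simp [hr]
  have hnorm : ∀ h, ∑ i ∈ Finset.Iic k, ⟪u i, w h⟫ ^ 2 + ‖r h‖ ^ 2 = 1 := by
    intro h
    have h1 : ⟪w h, w h⟫ = 1 := by rw [real_inner_self_eq_norm_sq, hw.1]; simp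
    have h2 : ⟪w h, r h⟫ = ‖r h‖ ^ 2 := by
      conv_lhs => rw [hww h]
      rw [inner_add_left, sum_inner, real_inner_self_eq_norm_sq]
      simp only [inner_smul_left]
      rw [Finset.sum_eq_zero fun i hi => by rw [hur h i (Finset.mem_Iic.1 hi), mul_zero]]
      simp
    rw [← h1]
    have h3 : ⟪w h, w h⟫ = ⟪w h, ∑ i ∈ Finset.Iic k, ⟪u i, w h⟫ • u i + r h⟫ := by rw [← hww h]
    rw [h3, inner_add_right, h2, inner_sum]
    congr 1
    refine Finset.sum_congr rfl fun i _ => ?_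
    rw [inner_smul_right, real_inner_comm]; ring
  have hform : ∀ h, A (w h) (w h) = ∑ i ∈ Finset.Iic k, μ i * ⟪u i, w h⟫ ^ 2 + A (r h) (r h) := by
    intro h
    have h2 : A (w h) (r h) = A (r h) (r h) := by
      conv_lhs => rw [hww h]
      simp only [map_add, map_sum, map_smul, LinearMap.add_apply, LinearMap.sum_apply,
        LinearMap.smul_apply, hu.eigen, smul_eq_mul]
      rw [Finset.sum_eq_zero fun i hi => by rw [hur h i (Finset.mem_Iic.1 hi)]; ring]
      simp
    conv_lhs => arg 2; rw [hww h]
    rw [map_add, h2, map_sum]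
    congr 1
    refine Finset.sum_congr rfl fun i _ => ?_
    rw [map_smul, hsymm, hu.eigen, smul_eq_mul]; ring
  -- Since `∑ ⟪u i, w h⟫² = 1 - ‖r h‖²`, the value `μ k` can be split off, leaving the nonpositive
  -- differences `μ i - μ k` and the remainder.
  have hkey : ∀ h, μ k + ∑ i ∈ Finset.Iic k, (μ i - μ k) * ⟪u i, w h⟫ ^ 2
      + (ν - μ k) * ‖r h‖ ^ 2 ≤ A (w h) (w h) := by
    intro h
    have h3 := hν (r h) (hur h)
    have h4 := hnorm h
    have h5 : ∑ i ∈ Finset.Iic k, (μ i - μ k) * ⟪u i, w h⟫ ^ 2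
        = ∑ i ∈ Finset.Iic k, μ i * ⟪u i, w h⟫ ^ 2 - μ k * ∑ i ∈ Finset.Iic k, ⟪u i, w h⟫ ^ 2 := by
      rw [Finset.mul_sum, ← Finset.sum_sub_distrib]
      exact Finset.sum_congr rfl fun i _ => by ring
    rw [hform h, h5]
    have h6 : ∑ i ∈ Finset.Iic k, ⟪u i, w h⟫ ^ 2 = 1 - ‖r h‖ ^ 2 := by linarith
    rw [h6]
    linarith
  refine le_trans ?_ (Finset.sum_le_sum fun h _ => hkey h)
  rw [Finset.sum_add_distrib, Finset.sum_add_distrib, ← Finset.mul_sum, Finset.sum_comm]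
  refine add_le_add_left ?_ _
  -- Bessel's inequality with the roles exchanged: `u i` is expanded along the `w h`. As `μ i - μ k
  -- ≤ 0`, a total weight at most `1` gives a lower bound.
  have h7 : ∀ i ∈ Finset.Iic k, (μ i - μ k) ≤
      ∑ h ∈ Finset.Iic k, (μ i - μ k) * ⟪u i, w h⟫ ^ 2 := by
    intro i hi
    rw [← Finset.mul_sum]
    have h8 : ∑ h ∈ Finset.Iic k, ⟪u i, w h⟫ ^ 2 ≤ 1 := by
      have := hw.sum_inner_products_le (s := Finset.Iic k) (u i)
      simpa [hu.orthonormal.1, real_inner_comm] using this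
    have h9 : μ i - μ k ≤ 0 := sub_nonpos.2 (hu.minmax_mono hsymm hb (Finset.mem_Iic.1 hi))
    nlinarith
  have h10 := Finset.sum_le_sum h7
  rw [Finset.sum_sub_distrib] at h10
  linarith

theorem exists_mem_ne_zero_orthogonal {k : ℕ} (u : Fin k → X) {F : Submodule ℝ X}
    (hF : k < finrank ℝ F) : ∃ x ∈ F, x ≠ 0 ∧ ∀ i, ⟪u i, x⟫ = 0 := by
  have : FiniteDimensional ℝ F := FiniteDimensional.of_finrank_pos (k.zero_le.trans_lt hF)
  let f : F →ₗ[ℝ] (Fin k → ℝ) := LinearMap.pi fun i => (innerₗ X (u i)).domRestrict F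
  have hf : LinearMap.ker f ≠ ⊥ := LinearMap.ker_ne_bot_of_finrank_lt (by simpa using hF)
  obtain ⟨x, hx, hx0⟩ := (Submodule.ne_bot_iff _).1 hf
  exact ⟨x, x.2, by simpa using hx0, fun i => congrFun (LinearMap.mem_ker.1 hx) i⟩

/-- The sublevel sets, cut with the constrained unit sphere, are nested nonempty compacts, so they
share a point. Neither completeness of `X` nor continuity of `A` is needed; `F` only ensures that
the constraint set is nonempty. -/
theorem exists_minimizer_orthogonal (hcpt : ∀ C, IsCompact {x : X | ‖x‖ ≤ 1 ∧ A x x ≤ C}) {k : ℕ}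
    (u : Fin k → X) {F : Submodule ℝ X} (hF : k < finrank ℝ F) :
    ∃ v : X, ‖v‖ = 1 ∧ (∀ i, ⟪u i, v⟫ = 0) ∧
      ∀ z, (∀ i, ⟪u i, z⟫ = 0) → A v v * ‖z‖ ^ 2 ≤ A z z := by
  let S : Set X := {x | ‖x‖ = 1 ∧ ∀ i, ⟪u i, x⟫ = 0}
  have hscale : ∀ x : X, x ≠ 0 → (∀ i, ⟪u i, x⟫ = 0) → ‖x‖⁻¹ • x ∈ S := fun x hx0 hx =>
    ⟨by rw [norm_smul, norm_inv, norm_norm, inv_mul_cancel₀ (norm_ne_zero_iff.2 hx0)],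
      fun i => by rw [inner_smul_right, hx, mul_zero]⟩
  obtain ⟨x₀, -, hx0, hx⟩ := exists_mem_ne_zero_orthogonal u hF
  have : Nonempty S := ⟨⟨_, hscale x₀ hx0 hx⟩⟩
  have hS : IsClosed S := by
    refine (isClosed_eq continuous_norm continuous_const).inter ?_
    have : {x : X | ∀ i, ⟪u i, x⟫ = 0} = ⋂ i, {x | ⟪u i, x⟫ = 0} := by ext; simp
    change IsClosed {x : X | ∀ i, ⟪u i, x⟫ = 0}
    rw [this]
    exact isClosed_iInter fun i => isClosed_eq (by fun_prop) continuous_const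
  let t : S → Set X := fun p => {x : X | ‖x‖ ≤ 1 ∧ A x x ≤ A p p} ∩ S
  have ht : ∀ p, IsCompact (t p) := fun p => (hcpt _).inter_right hS
  obtain ⟨v, hv⟩ := IsCompact.nonempty_iInter_of_directed_nonempty_isCompact_isClosed t
    (fun p q => by
      rcases le_total (A p p) (A q q) with h | h
      · exact ⟨p, subset_rfl, fun x hx => ⟨⟨hx.1.1, hx.1.2.trans h⟩, hx.2⟩⟩
      · exact ⟨q, fun x hx => ⟨⟨hx.1.1, hx.1.2.trans h⟩, hx.2⟩, subset_rfl⟩)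
    (fun p => ⟨p, ⟨p.2.1.le, le_rfl⟩, p.2⟩) ht (fun p => (ht p).isClosed)
  rw [Set.mem_iInter] at hv
  obtain ⟨p⟩ := this
  refine ⟨v, (hv p).2.1, (hv p).2.2, fun z hz => ?_⟩
  rcases eq_or_ne z 0 with rfl | hz0
  · simp
  have h := (hv ⟨_, hscale z hz0 hz⟩).1.2
  have hzp := norm_pos_iff.2 hz0
  simp only [map_smul, LinearMap.smul_apply, smul_eq_mul] at h
  calc A v v * ‖z‖ ^ 2 ≤ (‖z‖⁻¹ * (‖z‖⁻¹ * A z z)) * ‖z‖ ^ 2 := by gcongr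
    _ = A z z := by field_simp

/-- The first variation of a constrained minimizer. -/
theorem eigen_of_minimizer (hsymm : ∀ x y, A x y = A y x) {k : ℕ} {u : Fin k → X}
    (hu : IsEigenSystem A u) {v : X} (hv : ‖v‖ = 1) (huv : ∀ i, ⟪u i, v⟫ = 0)
    (hmin : ∀ z, (∀ i, ⟪u i, z⟫ = 0) → A v v * ‖z‖ ^ 2 ≤ A z z) (z : X) :
    A v z = A v v * ⟪v, z⟫ := by
  have key : ∀ z, (∀ i, ⟪u i, z⟫ = 0) → A v z = A v v * ⟪v, z⟫ := by
    intro z hz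
    -- A quadratic in `t` without constant term that stays nonnegative has zero linear coefficient;
    -- this is read off its discriminant.
    have h : ∀ t : ℝ, 0 ≤ (A z z - A v v * ‖z‖ ^ 2) * (t * t) +
        (2 * (A v z - A v v * ⟪v, z⟫)) * t + 0 := by
      intro t
      have := hmin (v + t • z) fun i => by rw [inner_add_right, inner_smul_right, huv, hz]; simp
      simp only [map_add, map_smul, LinearMap.add_apply, LinearMap.smul_apply, smul_eq_mul,
        norm_add_sq_real, inner_smul_right, norm_smul, hv, Real.norm_eq_abs, mul_pow, sq_abs,
        hsymm z v] at this
      nlinarith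
    have := discrim_le_zero h
    rw [discrim] at this
    have h0 : (A v z - A v v * ⟪v, z⟫) ^ 2 ≤ 0 := by nlinarith
    nlinarith [pow_eq_zero_iff (two_ne_zero) |>.1 (le_antisymm h0 (sq_nonneg _))]
  -- The component along the earlier eigenvectors contributes zero to both sides, so admissible
  -- variations are enough.
  set y := ∑ i, ⟪u i, z⟫ • u i with hy
  have h1 : A v y = 0 := by
    rw [hy, map_sum]
    exact Finset.sum_eq_zero fun i _ => by rw [map_smul, hsymm, hu.eigen, huv]; simp
  have h2 : ⟪v, y⟫ = 0 := by
    rw [hy, inner_sum]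
    exact Finset.sum_eq_zero fun i _ => by
      rw [inner_smul_right, real_inner_comm (u i) v, huv, mul_zero]
  have h3 := key (z - y) fun i => by
    rw [inner_sub_right, hy, inner_sum]
    simp [inner_smul_right, orthonormal_iff_ite.1 hu.orthonormal]
  rwa [map_sub, h1, inner_sub_right, h2, sub_zero, sub_zero] at h3

theorem IsEigenSystem.exists_snoc (hsymm : ∀ x y, A x y = A y x) (hb : ∀ x, b * ‖x‖ ^ 2 ≤ A x x)
    (hcpt : ∀ C, IsCompact {x : X | ‖x‖ ≤ 1 ∧ A x x ≤ C}) {k : ℕ} {u : Fin k → X}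
    (hu : IsEigenSystem A u) {F : Submodule ℝ X} (hF : k < finrank ℝ F) :
    ∃ v : X, IsEigenSystem A (Fin.snoc u v : Fin (k + 1) → X) := by
  obtain ⟨v, hv, huv, hmin⟩ := exists_minimizer_orthogonal hcpt u hF
  have hon := orthonormal_snoc hu.orthonormal hv huv
  have hmm : minmax A (k + 1) = A v v := by
    refine le_antisymm ?_ ?_
    · refine minmax_succ_le hsymm hb hu.orthonormal (ν := fun i => minmax A (i + 1)) hu.eigen hv
        huv fun i => ?_
      simpa [hv] using hu.minmax_mul_le hsymm hb i i.2.le v fun j _ => huv j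
    -- Every `(k + 1)`-dimensional subspace contains a nonzero vector orthogonal to the `k` earlier
    -- eigenvectors, where minimality of `v` applies.
    · refine SchrodingerSpectral.le_minmax k.succ_pos
        ⟨_, (finrank_span_eq_card hon.linearIndependent).trans (Fintype.card_fin _)⟩ fun G hG => ?_
      obtain ⟨x, hx, hx0, hux⟩ := exists_mem_ne_zero_orthogonal u (F := G) (by omega)
      exact ⟨x, hx, hx0, hmin x hux⟩
  refine ⟨v, hon, fun i z => ?_⟩
  induction i using Fin.lastCases with
  | last => simpa [hmm] using eigen_of_minimizer hsymm hu hv huv hmin z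
  | cast i => simpa using hu.eigen i z

theorem exists_isEigenSystem (hsymm : ∀ x y, A x y = A y x) (hb : ∀ x, b * ‖x‖ ^ 2 ≤ A x x)
    (hcpt : ∀ C, IsCompact {x : X | ‖x‖ ≤ 1 ∧ A x x ≤ C}) {F : Submodule ℝ X} (n : ℕ)
    (hn : n ≤ finrank ℝ F) : ∃ u : Fin n → X, IsEigenSystem A u := by
  induction n with
  | zero => exact ⟨Fin.elim0, ⟨⟨fun i => i.elim0, fun i => i.elim0⟩, fun i => i.elim0⟩⟩
  | succ n ih =>
    obtain ⟨u, hu⟩ := ih (by omega)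
    obtain ⟨v, hv⟩ := hu.exists_snoc hsymm hb hcpt hn
    exact ⟨_, hv⟩

end MinMax


/-! ### Infima of affine functions and their differentiability -/

section Danskin

variable {T H : Type*} [NormedAddCommGroup H] [InnerProductSpace ℝ H]

/-- The infimum over `U` of the affine functions `W ↦ e w + ⟪q w, W⟫`. -/
noncomputable def infAffine (U : Set T) (e : T → ℝ) (q : T → H) (W : H) : ℝ :=
  sInf ((fun w => e w + ⟪q w, W⟫) '' U)

variable {U : Set T} {e : T → ℝ} {q : T → H} {C : ℝ}

theorem infAffine_le (he : ∀ w ∈ U, 0 ≤ e w) (hq : ∀ w ∈ U, ‖q w‖ ≤ C) {w : T} (hw : w ∈ U)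
    (W : H) : infAffine U e q W ≤ e w + ⟪q w, W⟫ := by
  refine csInf_le ⟨-(C * ‖W‖), ?_⟩ ⟨w, hw, rfl⟩
  rintro _ ⟨w, hw, rfl⟩
  have h1 := (abs_le.1 (abs_real_inner_le_norm (q w) W)).1
  have h2 := mul_le_mul_of_nonneg_right (hq w hw) (norm_nonneg W)
  have h3 := he w hw
  dsimp only
  linarith

theorem infAffine_sub_le (he : ∀ w ∈ U, 0 ≤ e w) (hq : ∀ w ∈ U, ‖q w‖ ≤ C) {w : T} (hw : w ∈ U)
    {V : H} (hV : infAffine U e q V = e w + ⟪q w, V⟫) (W : H) :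
    infAffine U e q W - infAffine U e q V ≤ ⟪q w, W - V⟫ := by
  have := infAffine_le he hq hw W
  rw [hV, inner_sub_right]
  linarith

theorem infAffine_le_add (hU : U.Nonempty) (he : ∀ w ∈ U, 0 ≤ e w) (hq : ∀ w ∈ U, ‖q w‖ ≤ C)
    (V W : H) : infAffine U e q W ≤ infAffine U e q V + C * ‖W - V‖ := by
  rw [← sub_le_iff_le_add]
  refine le_csInf (hU.image _) ?_
  rintro _ ⟨w, hw, rfl⟩
  have h1 := infAffine_le he hq hw W
  have h2 := (abs_le.1 (abs_real_inner_le_norm (q w) (W - V))).2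
  have h3 := mul_le_mul_of_nonneg_right (hq w hw) (norm_nonneg (W - V))
  rw [inner_sub_right] at h2
  dsimp only
  linarith

theorem abs_infAffine_sub_le (hU : U.Nonempty) (he : ∀ w ∈ U, 0 ≤ e w) (hq : ∀ w ∈ U, ‖q w‖ ≤ C)
    (V W : H) : |infAffine U e q W - infAffine U e q V| ≤ C * ‖W - V‖ := by
  have h1 := infAffine_le_add hU he hq V W
  have h2 := infAffine_le_add hU he hq W V
  rw [norm_sub_rev] at h2
  exact abs_le.2 ⟨by linarith, by linarith⟩

/-- If the slopes of the almost minimizing affine functions converge, then the infimum is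
differentiable from below. -/
theorem eventually_le_infAffine_sub (hU : U.Nonempty) (he : ∀ w ∈ U, 0 ≤ e w)
    (hq : ∀ w ∈ U, ‖q w‖ ≤ C) {V q₀ : H}
    (hlim : Tendsto q (comap (fun w => e w + ⟪q w, V⟫) (𝓝 (infAffine U e q V)) ⊓ 𝓟 U) (𝓝 q₀))
    {ε : ℝ} (hε : 0 < ε) :
    ∀ᶠ W in 𝓝 V, -(ε * ‖W - V‖) ≤ infAffine U e q W - infAffine U e q V - ⟪q₀, W - V⟫ := by
  obtain ⟨w₀, hw₀⟩ := hU
  have hC : 0 ≤ C := (norm_nonneg _).trans (hq w₀ hw₀)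
  have hb := hlim.eventually (Metric.ball_mem_nhds q₀ (half_pos hε))
  rw [eventually_inf_principal, eventually_comap] at hb
  obtain ⟨δ, hδ, hball⟩ := Metric.eventually_nhds_iff.1 hb
  -- Passing from `W` to `V` and back costs at most `2 * C * ‖W - V‖ < δ / 2`, so a `δ /
  -- 2`-minimizer at `W` has value within `δ` of the infimum at `V`.
  have hr : 0 < δ / (4 * (C + 1)) := by positivity
  filter_upwards [Metric.ball_mem_nhds V hr] with W hW
  rw [mem_ball_iff_norm, lt_div_iff₀ (by positivity)] at hW
  rcases eq_or_ne W V with rfl | hne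
  · simp
  have ht : 0 < ‖W - V‖ := norm_pos_iff.2 (sub_ne_zero.2 hne)
  -- The first tolerance takes half of the allowed error, the slope of `w` taking the other half;
  -- the second makes `w` almost minimizing at `V`.
  have hm : 0 < min (ε * ‖W - V‖ / 2) (δ / 2) := by positivity
  obtain ⟨_, ⟨w, hw, rfl⟩, hlt⟩ := Real.lt_sInf_add_pos
    (Set.Nonempty.image (fun w => e w + ⟪q w, W⟫) ⟨w₀, hw₀⟩) hm
  have hlt1 := hlt.trans_le (add_le_add_right (min_le_left _ _) _)
  have hlt2 := hlt.trans_le (add_le_add_right (min_le_right _ _) _)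
  change _ < infAffine U e q W + _ at hlt1 hlt2
  have h1 := infAffine_le he hq hw V
  have h2 := infAffine_le_add ⟨w₀, hw₀⟩ he hq V W
  have h3 := (abs_le.1 (abs_real_inner_le_norm (q w) (W - V))).1
  have h4 := mul_le_mul_of_nonneg_right (hq w hw) (norm_nonneg (W - V))
  have h5 := inner_sub_right (𝕜 := ℝ) (q w) W V
  have hclose : ‖q w - q₀‖ < ε / 2 := by
    have := hball (y := e w + ⟪q w, V⟫) (by
      rw [Real.dist_eq, abs_lt]
      constructor <;> nlinarith) w rfl hw
    rwa [dist_eq_norm] at this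
  have h6 := (abs_le.1 (abs_real_inner_le_norm (q w - q₀) (W - V))).1
  have h7 := mul_le_mul_of_nonneg_right hclose.le ht.le
  rw [inner_sub_left] at h6
  linarith

end Danskin

/-! ### Summation by parts and the chain rule through increments -/

section Increments

variable {J : ℕ}

/-- The weights arising from summation by parts against `increments`. -/
def decrements (p : Fin J → ℝ) (k : Fin J) : ℝ :=
  p k - if h : (k : ℕ) + 1 < J then p ⟨k + 1, h⟩ else 0

theorem sum_mul_increments (p t : Fin J → ℝ) :
    ∑ i, p i * increments t i = ∑ k, decrements p k * t k := by
  cases J with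
  | zero => simp
  | succ n =>
    have h1 : ∑ i, p i * increments t i =
        p 0 * t 0 + ∑ i : Fin n, p i.succ * (t i.succ - t i.castSucc) := by
      rw [Fin.sum_univ_succ]
      rfl
    have h2 : ∑ k, decrements p k * t k =
        ∑ i : Fin n, (p i.castSucc - p i.succ) * t i.castSucc + p (Fin.last n) * t (Fin.last n) := by
      rw [Fin.sum_univ_castSucc]
      congr 1
      · refine Finset.sum_congr rfl fun i _ => ?_
        simp [decrements, Fin.succ]
      · simp [decrements]
    have h3 := Fin.sum_univ_succ fun i => p i * t i
    rw [Fin.sum_univ_castSucc] at h3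
    rw [h1, h2]
    simp only [mul_sub, sub_mul, Finset.sum_sub_distrib]
    linarith

theorem increments_sub (s t : Fin J → ℝ) :
    increments (fun i => s i - t i) = increments s - increments t := by
  ext i
  simp only [increments, Pi.sub_apply]
  split_ifs <;> ring

theorem norm_increments_le {s : Fin J → ℝ} {C : ℝ} (hC : 0 ≤ C) (hs : ∀ i, |s i| ≤ C) :
    ‖increments s‖ ≤ 2 * C := by
  refine (pi_norm_le_iff_of_nonneg (by positivity)).2 fun i => ?_
  rw [Real.norm_eq_abs, increments]
  split_ifs
  · linarith [hs i]
  · refine (abs_sub _ _).trans ?_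
    linarith [hs i, hs ⟨i - 1, by omega⟩]

theorem increments_sum_Iic (t : Fin J → ℝ) :
    increments (fun i => ∑ h ∈ Finset.Iic i, t h) = t := by
  cases J with
  | zero => ext i; exact i.elim0
  | succ n =>
    ext i
    induction i using Fin.cases with
    | zero =>
      have : Finset.Iic (0 : Fin (n + 1)) = {0} := by ext; simp
      simp [increments, this]
    | succ i =>
      have : Finset.Iic i.succ = insert i.succ (Finset.Iic i.castSucc) := by
        ext j
        simp only [Finset.mem_Iic, Finset.mem_insert, Fin.le_def, Fin.ext_iff, Fin.val_succ,
          Fin.val_castSucc]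
        omega
      change ∑ h ∈ Finset.Iic i.succ, t h - ∑ h ∈ Finset.Iic i.castSucc, t h = t i.succ
      rw [this, Finset.sum_insert (by simp [Fin.le_def])]
      ring

variable {H : Type*} [NormedAddCommGroup H] [InnerProductSpace ℝ H]

/-- The chain rule for superdifferentials through `increments`, where only those components whose
weight is not known to be nonnegative are required to be differentiable. -/
theorem eventually_comp_increments_sub_le {σ : Fin J → H → ℝ} {Q : Fin J → H} {V : H} {C : ℝ}
    (hC : 0 ≤ C) (hlip : ∀ k W, |σ k W - σ k V| ≤ C * ‖W - V‖)
    (hsuper : ∀ k W, σ k W - σ k V ≤ ⟪Q k, W - V⟫)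
    {f : (Fin J → ℝ) → ℝ} {L : (Fin J → ℝ) →L[ℝ] ℝ} {S : Set (Fin J → ℝ)} {T : Set H}
    (hf : HasFDerivWithinAt f L S (increments fun k => σ k V))
    (hT : ∀ W ∈ T, (increments fun k => σ k W) ∈ S)
    (hdiff : ∀ k, 0 ≤ decrements (fun i => L (Pi.single i 1)) k ∨ ∀ ε > 0, ∀ᶠ W in 𝓝 V,
      -(ε * ‖W - V‖) ≤ σ k W - σ k V - ⟪Q k, W - V⟫) {ε : ℝ} (hε : 0 < ε) :
    ∀ᶠ W in 𝓝 V, W ∈ T → f (increments fun k => σ k W) - f (increments fun k => σ k V) -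
      ∑ i, L (Pi.single i 1) * increments (fun k => ⟪Q k, W - V⟫) i ≤ ε * ‖W - V‖ := by
  set d := decrements fun i => L (Pi.single i 1) with hd
  have hL : ∀ y : Fin J → ℝ, L y = ∑ i, L (Pi.single i 1) * y i := by
    intro y
    conv_lhs => rw [pi_eq_sum_univ' y]
    rw [map_sum]
    refine Finset.sum_congr rfl fun i _ => ?_
    rw [map_smul, smul_eq_mul, mul_comm]
  have hη : 0 < ε / 2 / (2 * C + 1) := by positivity
  have hf' := (hasFDerivWithinAt_iff_isLittleO.1 hf).def hη
  obtain ⟨δ, hδ, hball⟩ := Metric.eventually_nhds_iff.1 (eventually_nhdsWithin_iff.1 hf')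
  -- The defect of `σ k` is always nonpositive, so a nonnegative weight needs nothing more.
  -- Otherwise the defect is `o(‖W - V‖)`. The divisor `J + 1` shares the error among `J` terms and
  -- is never zero.
  have hterm : ∀ k, ∀ᶠ W in 𝓝 V, d k * (σ k W - σ k V - ⟪Q k, W - V⟫)
      ≤ ε / 2 / (J + 1) * ‖W - V‖ := by
    intro k
    rcases hdiff k with h | h
    · refine Eventually.of_forall fun W => ?_
      refine (mul_nonpos_of_nonneg_of_nonpos h (sub_nonpos.2 (hsuper k W))).trans (by positivity)
    · filter_upwards [h (ε / 2 / (J + 1) / (|d k| + 1)) (by positivity)] with W hW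
      have h1 : |σ k W - σ k V - ⟪Q k, W - V⟫| ≤ ε / 2 / (J + 1) / (|d k| + 1) * ‖W - V‖ := by
        rw [abs_of_nonpos (sub_nonpos.2 (hsuper k W))]; linarith
      calc _ ≤ |d k| * |σ k W - σ k V - ⟪Q k, W - V⟫| := by
            rw [← abs_mul]; exact le_abs_self _
        _ ≤ (|d k| + 1) * (ε / 2 / (J + 1) / (|d k| + 1) * ‖W - V‖) := by
            gcongr; linarith
        _ = _ := by field_simp
  have hr : 0 < δ / (2 * C + 1) := by positivity
  filter_upwards [eventually_all.2 hterm, Metric.ball_mem_nhds V hr] with W hW hWV hWT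
  rw [mem_ball_iff_norm, lt_div_iff₀ (by positivity)] at hWV
  have hn : ‖(increments fun k => σ k W) - increments fun k => σ k V‖ ≤ 2 * (C * ‖W - V‖) := by
    rw [← increments_sub]
    exact norm_increments_le (by positivity) fun k => hlip k W
  have h1 := hball (y := increments fun k => σ k W) (by
    rw [dist_eq_norm]
    nlinarith [norm_nonneg (W - V)]) (hT W hWT)
  rw [Real.norm_eq_abs] at h1
  have h2 : ε / 2 / (2 * C + 1) * ‖(increments fun k => σ k W) - increments fun k => σ k V‖
      ≤ ε / 2 * ‖W - V‖ := by
    calc _ ≤ ε / 2 / (2 * C + 1) * ((2 * C + 1) * ‖W - V‖) := by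
          gcongr; nlinarith [norm_nonneg (W - V)]
      _ = _ := by field_simp
  have h3 := (abs_le.1 h1).2
  have h4 : L ((increments fun k => σ k W) - increments fun k => σ k V) -
      ∑ i, L (Pi.single i 1) * increments (fun k => ⟪Q k, W - V⟫) i
      = ∑ k, d k * (σ k W - σ k V - ⟪Q k, W - V⟫) := by
    rw [hL, ← Finset.sum_sub_distrib, hd, ← sum_mul_increments]
    refine Finset.sum_congr rfl fun i _ => ?_
    simp only [increments_sub, Pi.sub_apply, mul_sub]
  have h5 : ∑ k, d k * (σ k W - σ k V - ⟪Q k, W - V⟫) ≤ ε / 2 * ‖W - V‖ := by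
    calc _ ≤ ∑ _k : Fin J, ε / 2 / (J + 1) * ‖W - V‖ := Finset.sum_le_sum fun k _ => hW k
      _ = J / (J + 1) * (ε / 2 * ‖W - V‖) := by
          rw [Finset.sum_const, Finset.card_univ, Fintype.card_fin, nsmul_eq_mul]; ring
      _ ≤ 1 * (ε / 2 * ‖W - V‖) := by
          gcongr
          rw [div_le_one (by positivity)]; linarith
      _ = _ := one_mul _
  linarith

end Increments

/-! ### Convex `C¹` majorants of `o(‖h‖)` errors -/

section Barrier

variable {H : Type*} [NormedAddCommGroup H]

/-- A smooth convex regularization of the norm, vanishing at the origin. -/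
noncomputable def smoothNorm (s : ℝ) (h : H) : ℝ := √(s ^ 2 + ‖h‖ ^ 2) - s

theorem smoothNorm_nonneg (s : ℝ) (h : H) : 0 ≤ smoothNorm s h :=
  sub_nonneg.2 (Real.le_sqrt_of_sq_le (by nlinarith [sq_nonneg ‖h‖]))

theorem smoothNorm_zero {s : ℝ} (hs : 0 ≤ s) : smoothNorm s (0 : H) = 0 := by
  simp [smoothNorm, Real.sqrt_sq hs]

theorem smoothNorm_le (s : ℝ) (hs : 0 ≤ s) (h : H) : smoothNorm s h ≤ ‖h‖ := by
  rw [smoothNorm, sub_le_iff_le_add, Real.sqrt_le_left (by positivity)]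
  nlinarith [norm_nonneg h]

theorem half_norm_le_smoothNorm {s : ℝ} {h : H} (hs : 2 * s ≤ ‖h‖) : ‖h‖ / 2 ≤ smoothNorm s h := by
  have : ‖h‖ ≤ √(s ^ 2 + ‖h‖ ^ 2) := Real.le_sqrt_of_sq_le (by nlinarith [sq_nonneg s])
  rw [smoothNorm]
  linarith

variable [InnerProductSpace ℝ H]

/-- Up to the constant `s`, this is the Hilbert norm of `(s, h)`, that is, a norm restricted to an
affine subspace. -/
theorem convexOn_smoothNorm (s : ℝ) : ConvexOn ℝ univ (smoothNorm s : H → ℝ) := by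
  have hn : ∀ h : H, √(s ^ 2 + ‖h‖ ^ 2) = ‖WithLp.toLp 2 (s, h)‖ := by
    intro h; simp [WithLp.prod_norm_eq_of_L2]
  refine ⟨convex_univ, fun x _ y _ a b ha hb hab => ?_⟩
  have : WithLp.toLp 2 (s, a • x + b • y) = a • WithLp.toLp 2 (s, x) + b • WithLp.toLp 2 (s, y) := by
    rw [← WithLp.toLp_smul, ← WithLp.toLp_smul, ← WithLp.toLp_add]
    simp [← add_mul, hab]
  simp only [smoothNorm, hn, smul_eq_mul]
  rw [this]
  have h1 := norm_add_le (a • WithLp.toLp 2 (s, x)) (b • WithLp.toLp 2 (s, y))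
  rw [norm_smul, norm_smul, Real.norm_of_nonneg ha, Real.norm_of_nonneg hb] at h1
  have : s = a * s + b * s := by rw [← add_mul, hab, one_mul]
  linarith

theorem hasFDerivAt_smoothNorm {s : ℝ} (hs : 0 < s) (h : H) :
    HasFDerivAt (smoothNorm s) ((√(s ^ 2 + ‖h‖ ^ 2))⁻¹ • innerSL ℝ h) h := by
  have h1 : HasFDerivAt (fun x : H => s ^ 2 + ‖x‖ ^ 2) (2 • innerSL ℝ h) h :=
    (hasStrictFDerivAt_norm_sq h).hasFDerivAt.const_add _
  have h2 := (h1.sqrt (by positivity)).sub_const s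
  rwa [← Nat.cast_smul_eq_nsmul ℝ, smul_smul, show 1 / (2 * √(s ^ 2 + ‖h‖ ^ 2)) * ((2 : ℕ) : ℝ) =
    (√(s ^ 2 + ‖h‖ ^ 2))⁻¹ by push_cast; field_simp] at h2

theorem norm_fderiv_smoothNorm_le {s : ℝ} (hs : 0 < s) (h : H) :
    ‖(√(s ^ 2 + ‖h‖ ^ 2))⁻¹ • innerSL ℝ h‖ ≤ 1 := by
  rw [norm_smul, innerSL_apply_norm, norm_inv, Real.norm_of_nonneg (Real.sqrt_nonneg _),
    inv_mul_le_one₀ (by positivity)]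
  exact Real.le_sqrt_of_sq_le (by nlinarith [sq_nonneg s])

/-- Every error which is `o(‖h‖)` is dominated near the origin by a barrier. -/
theorem exists_isBarrier {T : Set H} {e : H → ℝ}
    (he : ∀ ε > 0, ∃ δ > 0, ∀ h ∈ T, ‖h‖ < δ → e h ≤ ε * ‖h‖) :
    ∃ (ω : H → ℝ) (ρ : ℝ), IsBarrier ω ∧ 0 < ρ ∧ ∀ h ∈ T, ‖h‖ < ρ → e h ≤ ω h := by
  choose δ hδ hδe using fun n : ℕ => he ((1 / 2) ^ n) (by positivity)
  -- The second entry forces `r n → 0`, so every nonzero `h` is eventually outside the ball of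
  -- radius `r n`.
  let r : ℕ → ℝ := fun n => min (δ n) (1 / (n + 1))
  have hr : ∀ n, 0 < r n := fun n => lt_min (hδ n) (by positivity)
  have hr0 : Tendsto r atTop (𝓝 0) :=
    squeeze_zero (fun n => (hr n).le) (fun n => min_le_right _ _)
      tendsto_one_div_add_atTop_nhds_zero_nat
  -- One factor `2` pays for the lower bound `‖h‖ / 2` of `smoothNorm`, the other for using the term
  -- `k + 1` against the error at scale `k`.
  let a : ℕ → ℝ := fun n => 4 * (1 / 2) ^ n
  have ha : ∀ n, 0 ≤ a n := fun n => by positivity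
  have hsum : Summable a := summable_geometric_two.mul_left 4
  let g : ℕ → H → ℝ := fun n h => a n * smoothNorm (r n / 2) h
  have hg0 : ∀ n h, 0 ≤ g n h := fun n h => mul_nonneg (ha n) (smoothNorm_nonneg _ _)
  have hgs : ∀ h, Summable fun n => g n h := fun h =>
    Summable.of_nonneg_of_le (fun n => hg0 n h)
      (fun n => mul_le_mul_of_nonneg_left (smoothNorm_le _ (half_pos (hr n)).le h) (ha n))
      (hsum.mul_right ‖h‖)
  let g' : ℕ → H → H →L[ℝ] ℝ := fun n h => a n • ((√((r n / 2) ^ 2 + ‖h‖ ^ 2))⁻¹ • innerSL ℝ h)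
  have hg' : ∀ n h, HasFDerivAt (g n) (g' n h) h := fun n h =>
    (hasFDerivAt_smoothNorm (half_pos (hr n)) h).const_mul (a n)
  have hg'n : ∀ n h, ‖g' n h‖ ≤ a n := fun n h => by
    rw [norm_smul, Real.norm_of_nonneg (ha n)]
    exact mul_le_of_le_one_right (ha n) (norm_fderiv_smoothNorm_le (half_pos (hr n)) h)
  have hω' := hasFDerivAt_tsum hsum hg' hg'n (hgs 0)
  have hzero : ∀ n, g n 0 = 0 := fun n => by
    simp [g, smoothNorm_zero (half_pos (hr n)).le]
  refine ⟨fun h => ∑' n, g n h, r 0, ⟨fun h => tsum_nonneg fun n => hg0 n h, ?_, ?_, ?_⟩, hr 0, ?_⟩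
  · rw [contDiff_one_iff_fderiv]
    refine ⟨fun h => (hω' h).differentiableAt, ?_⟩
    rw [show fderiv ℝ (fun h => ∑' n, g n h) = fun h => ∑' n, g' n h from
      funext fun h => (hω' h).fderiv]
    refine continuous_tsum (fun n => ?_) hsum hg'n
    have hc : Continuous fun h : H => (√((r n / 2) ^ 2 + ‖h‖ ^ 2))⁻¹ :=
      Continuous.inv₀ (by fun_prop) fun h => by have := hr n; positivity
    exact (hc.smul (innerSL ℝ : H →L⋆[ℝ] H →L[ℝ] ℝ).continuous).const_smul (a n)
  · refine ⟨convex_univ, fun x _ y _ s t hs ht hst => ?_⟩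
    rw [smul_eq_mul, smul_eq_mul, ← tsum_mul_left, ← tsum_mul_left,
      ← ((hgs x).mul_left s).tsum_add ((hgs y).mul_left t)]
    refine (hgs _).tsum_le_tsum (fun n => ?_) (((hgs x).mul_left s).add ((hgs y).mul_left t))
    have := mul_le_mul_of_nonneg_left
      ((convexOn_smoothNorm (r n / 2)).2 (mem_univ x) (mem_univ y) hs ht hst) (ha n)
    simp only [smul_eq_mul] at this
    simp only [g]
    linarith
  · simp [hzero]
  · intro h hT hh
    rcases eq_or_ne h 0 with rfl | hne
    · simpa [hzero] using hδe 0 0 hT (by simpa using hδ 0)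
    have hpos := norm_pos_iff.2 hne
    have hex : ∃ n, r n ≤ ‖h‖ := ((hr0.eventually_lt_const hpos).exists).imp fun n => le_of_lt
    classical
    -- The first index with `r n ≤ ‖h‖` is positive because `‖h‖ < r 0`. Its predecessor gives `‖h‖
    -- < r k ≤ δ k`, and the single term `k + 1` dominates the error. Monotonicity of `r` is not
    -- needed.
    obtain ⟨k, hk⟩ : ∃ k, Nat.find hex = k + 1 :=
      Nat.exists_eq_succ_of_ne_zero fun h0 => by
        have := Nat.find_spec hex
        rw [h0] at this
        exact absurd hh this.not_gt
    have h1 : r (k + 1) ≤ ‖h‖ := hk ▸ Nat.find_spec hex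
    have h2 : ‖h‖ < r k := not_le.1 (Nat.find_min hex (hk ▸ k.lt_succ_self))
    calc e h ≤ (1 / 2) ^ k * ‖h‖ := hδe k h hT (h2.trans_le (min_le_left _ _))
      _ = a (k + 1) * (‖h‖ / 2) := by simp only [a]; ring
      _ ≤ g (k + 1) h :=
          mul_le_mul_of_nonneg_left (half_norm_le_smoothNorm (by linarith)) (ha _)
      _ ≤ ∑' n, g n h := (hgs h).le_tsum (k + 1) fun n _ => hg0 n h

end Barrier


/-! ### Transport of the form to the image of its domain in `L²` -/

section FormDomain

open Module

variable {D : Type*} [MeasurableSpace D] {m : Measure D}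
  {𝕍 : Type*} [NormedAddCommGroup 𝕍] [InnerProductSpace ℝ 𝕍]
  {ι : 𝕍 →L[ℝ] Lp ℝ 2 m} {E : 𝕍 →L[ℝ] 𝕍 →L[ℝ] ℝ} {V : Lp ℝ 2 m}

theorem integrable_sq_coeFn (f : Lp ℝ 2 m) : Integrable (fun x => (f x) ^ 2) m :=
  (Lp.memLp f).integrable_sq

theorem norm_sq_eq_integral (f : Lp ℝ 2 m) : ‖f‖ ^ 2 = ∫ x, (f x) ^ 2 ∂m := by
  rw [← real_inner_self_eq_norm_sq, L2.inner_def]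
  simp [pow_two]

variable (ι V) in
/-- The form domain `D(E_V)` as a linear subspace. -/
def formSubmodule : Submodule ℝ 𝕍 where
  carrier := formDomain ι V
  zero_mem' := by
    refine (integrable_zero D ℝ m).congr ?_
    filter_upwards [Lp.coeFn_zero ℝ 2 m] with x hx
    rw [map_zero, hx]
    simp
  add_mem' {u v} hu hv := by
    refine Integrable.mono' ((hu.const_mul 2).add (hv.const_mul 2)) (by fun_prop) ?_
    rw [map_add]
    filter_upwards [Lp.coeFn_add (ι u) (ι v)] with x hx
    have h0 : 0 ≤ max (V x) 0 := le_max_right _ _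
    rw [hx, Real.norm_of_nonneg (by positivity), Pi.add_apply, Pi.add_apply]
    nlinarith [mul_nonneg h0 (sq_nonneg (ι u x - ι v x))]
  smul_mem' c u hu := by
    refine (hu.const_mul (c ^ 2)).congr ?_
    rw [map_smul]
    filter_upwards [Lp.coeFn_smul c (ι u)] with x hx
    rw [hx, Pi.smul_apply, smul_eq_mul]
    ring

theorem integrable_potential_mul_sq {b : ℝ} (hb : ∀ᵐ x ∂m, b ≤ V x) {u : 𝕍}
    (hu : u ∈ formDomain ι V) : Integrable (fun x => V x * (ι u x) ^ 2) m := by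
  refine Integrable.mono' (Integrable.add hu ((integrable_sq_coeFn (ι u)).const_mul |b|))
    (by fun_prop) ?_
  filter_upwards [hb] with x hx
  rw [norm_mul, Real.norm_of_nonneg (sq_nonneg _), Real.norm_eq_abs, Pi.add_apply, ← add_mul]
  refine mul_le_mul_of_nonneg_right (abs_le'.2 ⟨?_, ?_⟩) (sq_nonneg _)
  · linarith [le_max_left (V x) 0, abs_nonneg b]
  · linarith [le_max_right (V x) 0, neg_abs_le b]

theorem integrable_potential_mul_mul {b : ℝ} (hb : ∀ᵐ x ∂m, b ≤ V x) {u v : 𝕍}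
    (hu : u ∈ formDomain ι V) (hv : v ∈ formDomain ι V) :
    Integrable (fun x => V x * (ι u x * ι v x)) m := by
  refine Integrable.mono' ((integrable_potential_mul_sq hb hu).norm.add
    (integrable_potential_mul_sq hb hv).norm) (by fun_prop) (Eventually.of_forall fun x => ?_)
  simp only [norm_mul, norm_pow, Real.norm_eq_abs, Pi.add_apply]
  nlinarith [mul_nonneg (abs_nonneg (V x)) (sq_nonneg (|ι u x| - |ι v x|)),
    mul_nonneg (abs_nonneg (V x)) (sq_nonneg (|ι u x| + |ι v x|))]

theorem schrodingerForm_comm (hsymm : ∀ u v, E u v = E v u) (u v : 𝕍) :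
    schrodingerForm ι E V u v = schrodingerForm ι E V v u := by
  simp only [schrodingerForm, hsymm u v, mul_comm (ι u _)]

theorem schrodingerForm_add_left {b : ℝ} (hb : ∀ᵐ x ∂m, b ≤ V x) {u v w : 𝕍}
    (hu : u ∈ formDomain ι V) (hv : v ∈ formDomain ι V) (hw : w ∈ formDomain ι V) :
    schrodingerForm ι E V (u + v) w = schrodingerForm ι E V u w + schrodingerForm ι E V v w := by
  simp only [schrodingerForm, map_add, add_apply]
  have : ∫ x, V x * ((ι u + ι v : Lp ℝ 2 m) x * ι w x) ∂m =
      ∫ x, V x * (ι u x * ι w x) ∂m + ∫ x, V x * (ι v x * ι w x) ∂m := by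
    rw [← integral_add (integrable_potential_mul_mul hb hu hw)
      (integrable_potential_mul_mul hb hv hw)]
    refine integral_congr_ae ?_
    filter_upwards [Lp.coeFn_add (ι u) (ι v)] with x hx
    rw [hx, Pi.add_apply]
    ring
  rw [this]
  ring

theorem schrodingerForm_smul_left (c : ℝ) (u w : 𝕍) :
    schrodingerForm ι E V (c • u) w = c * schrodingerForm ι E V u w := by
  simp only [schrodingerForm, map_smul, smul_apply, smul_eq_mul]
  have : ∫ x, V x * ((c • ι u : Lp ℝ 2 m) x * ι w x) ∂m = c * ∫ x, V x * (ι u x * ι w x) ∂m := by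
    rw [← integral_const_mul]
    refine integral_congr_ae ?_
    filter_upwards [Lp.coeFn_smul c (ι u)] with x hx
    rw [hx, Pi.smul_apply, smul_eq_mul]
    ring
  rw [this]
  ring

variable (ι V) in
/-- The image of the form domain in `L²`, with the norm of `L²`. -/
abbrev FormSpace : Type _ := (formSubmodule ι V).map (ι : 𝕍 →ₗ[ℝ] Lp ℝ 2 m)

/-- The inverse of the embedding, on the image of the form domain. -/
noncomputable def formLift (hι : Function.Injective ι) (V : Lp ℝ 2 m) : FormSpace ι V →ₗ[ℝ] 𝕍 :=
  (formSubmodule ι V).subtype ∘ₗ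
    (Submodule.equivMapOfInjective (ι : 𝕍 →ₗ[ℝ] Lp ℝ 2 m) hι (formSubmodule ι V)).symm.toLinearMap

variable (hι : Function.Injective ι)

theorem formLift_mem (x : FormSpace ι V) : formLift hι V x ∈ formDomain ι V :=
  Subtype.mem _

theorem embed_formLift (x : FormSpace ι V) : ι (formLift hι V x) = x := by
  have h := LinearEquiv.apply_symm_apply
    (Submodule.equivMapOfInjective (ι : 𝕍 →ₗ[ℝ] Lp ℝ 2 m) hι (formSubmodule ι V)) x
  exact congrArg Subtype.val h

theorem formLift_injective : Function.Injective (formLift hι V) := fun x y h => by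
  rw [Subtype.ext_iff, ← embed_formLift hι x, ← embed_formLift hι y, h]

theorem norm_embed_formLift (x : FormSpace ι V) : ‖ι (formLift hι V x)‖ = ‖x‖ := by
  rw [embed_formLift]; rfl

variable (ι V) in
theorem exists_formLift_eq {u : 𝕍} (hu : u ∈ formDomain ι V) :
    ∃ x : FormSpace ι V, formLift hι V x = u :=
  ⟨⟨ι u, u, hu, rfl⟩, hι (embed_formLift hι _)⟩

/-- The form `E_V` on the image of the form domain in `L²`. -/
noncomputable def liftedForm (E : 𝕍 →L[ℝ] 𝕍 →L[ℝ] ℝ) (hsymm : ∀ u v, E u v = E v u) {b : ℝ}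
    (hb : ∀ᵐ x ∂m, b ≤ V x) : FormSpace ι V →ₗ[ℝ] FormSpace ι V →ₗ[ℝ] ℝ :=
  LinearMap.mk₂ ℝ (fun x y => schrodingerForm ι E V (formLift hι V x) (formLift hι V y))
    (fun x y z => by
      rw [map_add, schrodingerForm_add_left hb] <;> exact formLift_mem hι _)
    (fun c x y => by rw [map_smul, schrodingerForm_smul_left, smul_eq_mul])
    (fun x y z => by
      rw [map_add, schrodingerForm_comm hsymm, schrodingerForm_add_left hb,
        schrodingerForm_comm hsymm, schrodingerForm_comm hsymm (formLift hι V z)] <;>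
      exact formLift_mem hι _)
    (fun c x y => by
      rw [map_smul, schrodingerForm_comm hsymm, schrodingerForm_smul_left,
        schrodingerForm_comm hsymm, smul_eq_mul])

variable (hsymm : ∀ u v, E u v = E v u) {b : ℝ} (hb : ∀ᵐ x ∂m, b ≤ V x)

theorem liftedForm_apply (x y : FormSpace ι V) : liftedForm hι E hsymm hb x y =
    schrodingerForm ι E V (formLift hι V x) (formLift hι V y) := rfl

theorem liftedForm_comm (x y : FormSpace ι V) :
    liftedForm hι E hsymm hb x y = liftedForm hι E hsymm hb y x :=
  schrodingerForm_comm hsymm _ _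

theorem quotient_set_eq (G : Submodule ℝ (FormSpace ι V)) :
    {q : ℝ | ∃ x ∈ G, x ≠ 0 ∧ q = liftedForm hι E hsymm hb x x / ‖x‖ ^ 2} =
      {q : ℝ | ∃ u ∈ G.map (formLift hι V), u ≠ 0 ∧
        q = schrodingerForm ι E V u u / ‖ι u‖ ^ 2} := by
  ext q
  constructor
  · rintro ⟨x, hx, hx0, rfl⟩
    refine ⟨_, ⟨x, hx, rfl⟩, fun h => hx0 (formLift_injective hι (h.trans (map_zero _).symm)), ?_⟩
    rw [norm_embed_formLift, liftedForm_apply]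
  · rintro ⟨_, ⟨x, hx, rfl⟩, hx0, rfl⟩
    refine ⟨x, hx, fun h => hx0 (by rw [h, map_zero]), ?_⟩
    rw [norm_embed_formLift, liftedForm_apply]

/-- `formLift` maps subspaces bijectively onto the subspaces of `𝕍` inside the form domain,
preserving dimension and Rayleigh quotients. -/
theorem minmax_liftedForm (k : ℕ) : minmax (liftedForm hι E hsymm hb) k = eigenvalue ι E V k := by
  rw [minmax, eigenvalue]
  congr 1
  ext r
  constructor
  · rintro ⟨G, hG, rfl⟩
    refine ⟨G.map (formLift hι V), ?_, ?_, by rw [quotient_set_eq]⟩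
    · rintro _ ⟨x, -, rfl⟩
      exact formLift_mem hι x
    · rw [← hG]
      exact (LinearEquiv.finrank_eq
        (Submodule.equivMapOfInjective _ (formLift_injective hι) G)).symm
  · rintro ⟨F, hF, hk, rfl⟩
    have hmap : (F.comap (formLift hι V)).map (formLift hι V) = F := by
      refine le_antisymm (Submodule.map_comap_le _ _) fun u hu => ?_
      obtain ⟨x, rfl⟩ := exists_formLift_eq ι V hι (hF hu)
      exact ⟨x, hu, rfl⟩
    refine ⟨F.comap (formLift hι V), ?_, by rw [quotient_set_eq, hmap]⟩
    rw [← hk]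
    conv_rhs => rw [← hmap]
    exact LinearEquiv.finrank_eq
      (Submodule.equivMapOfInjective _ (formLift_injective hι) (F.comap (formLift hι V)))

theorem isEigenSystem_liftedForm_iff {J : ℕ} {x : Fin J → FormSpace ι V} :
    IsEigenSystem (liftedForm hι E hsymm hb) x ↔
      (fun i => formLift hι V (x i)) ∈ eigenSystems ι E J V := by
  have hinner : ∀ x y : FormSpace ι V,
      ⟪ι (formLift hι V x), ι (formLift hι V y)⟫ = ⟪x, y⟫ := fun x y => by
    rw [embed_formLift, embed_formLift]; rfl
  constructor
  · intro h
    refine ⟨fun i => ⟨⟨formLift_mem hι _, fun h0 => ?_, fun v hv => ?_⟩, ?_⟩, fun i j hij => ?_⟩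
    · have : x i = 0 := formLift_injective hι (h0.trans (map_zero _).symm)
      exact h.orthonormal.ne_zero i this
    · obtain ⟨y, rfl⟩ := exists_formLift_eq ι V hι hv
      rw [← liftedForm_apply hι hsymm hb, h.eigen, minmax_liftedForm, hinner]
      rfl
    · rw [norm_embed_formLift, h.orthonormal.1]
    · rw [hinner, h.orthonormal.2 hij]
  · rintro ⟨h1, h2⟩
    refine ⟨⟨fun i => ?_, fun i j hij => ?_⟩, fun i y => ?_⟩
    · rw [← norm_embed_formLift hι, (h1 i).2]
    · exact (hinner _ _).symm.trans (h2 i j hij)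
    · rw [liftedForm_apply, (h1 i).1.2.2 _ (formLift_mem hι y), minmax_liftedForm, hinner]
      rfl

end FormDomain

/-! ### Compact sublevels of the Schrödinger form -/

section Compactness

variable {D : Type*} [MeasurableSpace D] {m : Measure D}
  {𝕍 : Type*} [NormedAddCommGroup 𝕍] [InnerProductSpace ℝ 𝕍]
  {ι : 𝕍 →L[ℝ] Lp ℝ 2 m} {E : 𝕍 →L[ℝ] 𝕍 →L[ℝ] ℝ} {V : Lp ℝ 2 m} {b : ℝ}

/-- Fatou's lemma along an a.e. convergent subsequence. The bound is a second variable because it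
varies with the point when the lemma is applied. -/
theorem isClosed_lintegral_potential_le (V : Lp ℝ 2 m) (b : ℝ) :
    IsClosed {p : Lp ℝ 2 m × ℝ |
      ∫⁻ x, ENNReal.ofReal ((V x - b) * (p.1 x) ^ 2) ∂m ≤ ENNReal.ofReal p.2} := by
  rw [← isSeqClosed_iff_isClosed]
  intro s p hs hp
  rw [Prod.tendsto_iff] at hp
  obtain ⟨φ, hφ, hae⟩ := (tendstoInMeasure_of_tendsto_Lp hp.1).exists_seq_tendsto_ae
  have h1 : ∫⁻ x, ENNReal.ofReal ((V x - b) * (p.1 x) ^ 2) ∂m =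
      ∫⁻ x, liminf (fun n => ENNReal.ofReal ((V x - b) * ((s (φ n)).1 x) ^ 2)) atTop ∂m := by
    refine lintegral_congr_ae ?_
    filter_upwards [hae] with x hx
    exact (Tendsto.liminf_eq (ENNReal.tendsto_ofReal ((hx.pow 2).const_mul _))).symm
  have h2 : Tendsto (fun n => ENNReal.ofReal (s (φ n)).2) atTop (𝓝 (ENNReal.ofReal p.2)) :=
    ENNReal.tendsto_ofReal (hp.2.comp hφ.tendsto_atTop)
  calc _ = _ := h1
    _ ≤ liminf (fun n => ∫⁻ x, ENNReal.ofReal ((V x - b) * ((s (φ n)).1 x) ^ 2) ∂m) atTop :=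
        lintegral_liminf_le' fun n => by fun_prop
    _ ≤ liminf (fun n => ENNReal.ofReal (s (φ n)).2) atTop :=
        liminf_le_liminf (Eventually.of_forall fun n => hs (φ n))
    _ = _ := h2.liminf_eq

theorem integrable_sub_mul_sq (hb : ∀ᵐ x ∂m, b ≤ V x) {u : 𝕍} (hu : u ∈ formDomain ι V) :
    Integrable (fun x => (V x - b) * (ι u x) ^ 2) m := by
  simp only [sub_mul]
  exact (integrable_potential_mul_sq hb hu).sub ((integrable_sq_coeFn (ι u)).const_mul b)

theorem lintegral_sub_mul_sq (hb : ∀ᵐ x ∂m, b ≤ V x) {u : 𝕍} (hu : u ∈ formDomain ι V) :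
    ∫⁻ x, ENNReal.ofReal ((V x - b) * (ι u x) ^ 2) ∂m =
      ENNReal.ofReal (schrodingerForm ι E V u u - E u u - b * ‖ι u‖ ^ 2) := by
  rw [← ofReal_integral_eq_lintegral_ofReal (integrable_sub_mul_sq hb hu)
    (hb.mono fun x hx => mul_nonneg (sub_nonneg.2 hx) (sq_nonneg _)), norm_sq_eq_integral]
  simp only [sub_mul]
  rw [integral_sub (integrable_potential_mul_sq hb hu) ((integrable_sq_coeFn (ι u)).const_mul b),
    integral_const_mul, schrodingerForm]
  simp [pow_two]

theorem le_schrodingerForm (hb : ∀ᵐ x ∂m, b ≤ V x) {u : 𝕍} (hu : u ∈ formDomain ι V) :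
    E u u + b * ‖ι u‖ ^ 2 ≤ schrodingerForm ι E V u u := by
  have h1 : 0 ≤ ∫ x, (V x - b) * (ι u x) ^ 2 ∂m := integral_nonneg_of_ae
    (hb.mono fun x hx => mul_nonneg (sub_nonneg.2 hx) (sq_nonneg _))
  simp only [sub_mul] at h1
  rw [integral_sub (integrable_potential_mul_sq hb hu) ((integrable_sq_coeFn (ι u)).const_mul b),
    integral_const_mul, ← norm_sq_eq_integral] at h1
  rw [schrodingerForm]
  simp only [← pow_two]
  linarith

theorem mem_formDomain_of_lintegral_lt_top (hb : ∀ᵐ x ∂m, b ≤ V x) {u : 𝕍}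
    (hu : ∫⁻ x, ENNReal.ofReal ((V x - b) * (ι u x) ^ 2) ∂m < ⊤) : u ∈ formDomain ι V := by
  have h1 : Integrable (fun x => (V x - b) * (ι u x) ^ 2) m := by
    refine ⟨by fun_prop, ?_⟩
    rwa [hasFiniteIntegral_iff_ofReal
      (hb.mono fun x hx => mul_nonneg (sub_nonneg.2 hx) (sq_nonneg _))]
  refine Integrable.mono' (h1.add ((integrable_sq_coeFn (ι u)).const_mul |b|)) (by fun_prop) ?_
  filter_upwards [hb] with x hx
  rw [Real.norm_of_nonneg (mul_nonneg (le_max_right _ _) (sq_nonneg _)), Pi.add_apply, ← add_mul]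
  refine mul_le_mul_of_nonneg_right (max_le ?_ ?_) (sq_nonneg _)
  · linarith [le_abs_self b]
  · linarith [abs_nonneg b]

/-- Coercivity bounds the sublevel in `𝕍`, so an ultrafilter on it converges strongly in `L²`
(compact embedding) and weakly in `𝕍` (Banach–Alaoglu), to the same limit. Both parts of the energy
are lower semicontinuous: `E` by positivity, the potential by Fatou. -/
theorem isCompact_sublevel_liftedForm [CompleteSpace 𝕍] {α M : ℝ} (hE : IsCoerciveForm ι E α M)
    (hb : ∀ᵐ x ∂m, b ≤ V x) (C : ℝ) :
    IsCompact {x : FormSpace ι V | ‖x‖ ≤ 1 ∧ liftedForm hE.injective E hE.symm hb x x ≤ C} := by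
  have hEnn : ∀ u, 0 ≤ E u u := fun u =>
    (mul_nonneg hE.alpha_nonneg (sq_nonneg _)).trans (hE.lower u)
  set s := formLift hE.injective V with hs
  rw [isCompact_iff_ultrafilter_le_nhds]
  intro f hf
  have hK : ∀ᶠ x in f, ‖x‖ ≤ 1 ∧ liftedForm hE.injective E hE.symm hb x x ≤ C :=
    le_principal_iff.1 hf
  -- From `‖s x‖² ≤ M * (E (s x) (s x) + ‖x‖²)` and `E (s x) (s x) ≤ C - b * ‖x‖²`, with `‖x‖ ≤ 1`.
  set R : ℝ := √(M * (C + |b| + 1)) with hR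
  have hbd : ∀ᶠ x in f, ‖s x‖ ≤ R := by
    filter_upwards [hK] with x hx
    refine Real.le_sqrt_of_sq_le ?_
    have h1 := hE.coercive (s x)
    have h2 := le_schrodingerForm (E := E) hb (formLift_mem hE.injective x)
    rw [norm_embed_formLift] at h1 h2
    have h3 : ‖x‖ ^ 2 ≤ 1 := by nlinarith [norm_nonneg x, hx.1]
    have h4 := hx.2
    rw [liftedForm_apply] at h4
    have h5 : -(b * ‖x‖ ^ 2) ≤ |b| := by nlinarith [neg_abs_le b, abs_nonneg b, sq_nonneg ‖x‖]
    rw [inv_mul_le_iff₀ hE.M_pos] at h1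
    refine h1.trans (mul_le_mul_of_nonneg_left ?_ hE.M_pos.le)
    linarith
  obtain ⟨y, -, hy⟩ := (hE.compact.isCompact_closure_image_closedBall R).ultrafilter_le_nhds'
    (Ultrafilter.map (fun x : FormSpace ι V => (x : Lp ℝ 2 m)) f)
    (Ultrafilter.mem_map.2 (mem_of_superset hbd fun x hx =>
      subset_closure ⟨s x, mem_closedBall_zero_iff.2 hx, embed_formLift hE.injective x⟩))
  have hy' : Tendsto (fun x : FormSpace ι V => (x : Lp ℝ 2 m)) f (𝓝 y) := hy
  obtain ⟨ℓ, -, hℓ⟩ := (WeakDual.isCompact_closedBall (𝕜 := ℝ) (0 : StrongDual ℝ 𝕍)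
    R).ultrafilter_le_nhds' (Ultrafilter.map (fun x => StrongDual.toWeakDual (innerSL ℝ (s x))) f)
    (Ultrafilter.mem_map.2 (mem_of_superset hbd fun x hx =>
      mem_closedBall_zero_iff.2 ((innerSL_apply_norm ℝ (s x)).trans_le hx)))
  have hℓ' : Tendsto (fun x => StrongDual.toWeakDual (innerSL ℝ (s x))) f (𝓝 ℓ) := hℓ
  set p : 𝕍 := (InnerProductSpace.toDual ℝ 𝕍).symm (WeakDual.toStrongDual ℓ) with hp
  have hweak : ∀ z, Tendsto (fun x => ⟪s x, z⟫) f (𝓝 ⟪p, z⟫) := by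
    intro z
    have h := ((WeakDual.eval_continuous z).tendsto ℓ).comp hℓ'
    rw [hp, InnerProductSpace.toDual_symm_apply]
    exact h
  have hpy : ι p = y := by
    refine ext_inner_right ℝ fun h => ?_
    refine tendsto_nhds_unique ?_ (hy'.inner tendsto_const_nhds)
    rw [← ContinuousLinearMap.adjoint_inner_right]
    refine (hweak (ContinuousLinearMap.adjoint ι h)).congr fun x => ?_
    rw [ContinuousLinearMap.adjoint_inner_right, embed_formLift]
  have hEp : Tendsto (fun x => E p (s x)) f (𝓝 (E p p)) := by
    have h := hweak ((InnerProductSpace.toDual ℝ 𝕍).symm (E p))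
    simp only [real_inner_comm ((InnerProductSpace.toDual ℝ 𝕍).symm (E p)),
      InnerProductSpace.toDual_symm_apply] at h
    exact h
  have hny : Tendsto (fun x : FormSpace ι V => ‖x‖) f (𝓝 ‖ι p‖) := by
    rw [hpy]; exact hy'.norm
  have ha : Tendsto (fun x : FormSpace ι V => C - 2 * E p (s x) + E p p - b * ‖x‖ ^ 2) f
      (𝓝 (C - E p p - b * ‖ι p‖ ^ 2)) := by
    convert (((hEp.const_mul 2).const_sub C).add_const (E p p)).sub ((hny.pow 2).const_mul b)
      using 2
    ring
  -- Positivity of `E` at `s x - p` gives `E (s x) (s x) ≥ 2 * E p (s x) - E p p`, whose right side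
  -- passes to the weak limit.
  have hle : ∀ᶠ x in f, schrodingerForm ι E V (s x) (s x) - E (s x) (s x) - b * ‖ι (s x)‖ ^ 2
      ≤ C - 2 * E p (s x) + E p p - b * ‖x‖ ^ 2 := by
    filter_upwards [hK] with x hx
    have h1 := hEnn (s x - p)
    simp only [map_sub, sub_apply] at h1
    have h2 := hx.2
    rw [liftedForm_apply] at h2
    rw [norm_embed_formLift]
    have h3 := hE.symm (s x) p
    linarith
  have hmem := (isClosed_lintegral_potential_le V b).mem_of_tendsto (hy'.prodMk_nhds ha) (by
    filter_upwards [hle] with x hx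
    have := lintegral_sub_mul_sq (E := E) hb (formLift_mem hE.injective x)
    rw [embed_formLift] at this
    refine this.le.trans (ENNReal.ofReal_le_ofReal ?_)
    rwa [hs, embed_formLift] at hx)
  -- Required to drop `ENNReal.ofReal`, which truncates negative numbers.
  have hnonneg : 0 ≤ C - E p p - b * ‖ι p‖ ^ 2 := by
    refine ge_of_tendsto ha ?_
    filter_upwards [hle] with x hx
    have := le_schrodingerForm (E := E) hb (formLift_mem hE.injective x)
    linarith
  change ∫⁻ x, ENNReal.ofReal ((V x - b) * (y x) ^ 2) ∂m ≤ ENNReal.ofReal _ at hmem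
  rw [← hpy] at hmem
  have hpd : p ∈ formDomain ι V :=
    mem_formDomain_of_lintegral_lt_top hb (hmem.trans_lt ENNReal.ofReal_lt_top)
  obtain ⟨x₀, hx₀⟩ := exists_formLift_eq ι V hE.injective hpd
  have hx₀p : (x₀ : Lp ℝ 2 m) = ι p := by rw [← hx₀, embed_formLift]
  refine ⟨x₀, ⟨?_, ?_⟩, ?_⟩
  · have : ‖x₀‖ = ‖ι p‖ := by rw [← hx₀p]; rfl
    rw [this]
    exact le_of_tendsto hny (hK.mono fun x hx => hx.1)
  · rw [lintegral_sub_mul_sq (E := E) hb hpd, ENNReal.ofReal_le_ofReal_iff hnonneg] at hmem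
    rw [liftedForm_apply, hx₀]
    linarith
  · rw [nhds_subtype_eq_comap, hx₀p, hpy]
    exact tendsto_iff_comap.1 hy'

end Compactness


/-! ### Squares of `L⁴` functions as elements of `L²` -/

section SquareL4

variable {D : Type*} [MeasurableSpace D] {m : Measure D}

instance holderTriple_four_four_two : ENNReal.HolderTriple 4 4 2 where
  inv_add_inv_eq_inv := by
    rw [← two_mul, show (4 : ℝ≥0∞) = 2 * 2 by norm_num, ENNReal.mul_inv (by simp) (by simp),
      ← mul_assoc, ENNReal.mul_inv_cancel (by simp) (by simp), one_mul]

variable (m) in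
/-- Multiplication `L⁴ × L⁴ → L²`. -/
noncomputable def mulL4 : Lp ℝ 4 m →L[ℝ] Lp ℝ 4 m →L[ℝ] Lp ℝ 2 m :=
  (ContinuousLinearMap.mul ℝ ℝ).holderL m 4 4 2

theorem coeFn_mulL4 (f g : Lp ℝ 4 m) : mulL4 m f g =ᵐ[m] fun x => f x * g x :=
  (ContinuousLinearMap.mul ℝ ℝ).coeFn_holder f g

open Classical in
/-- The function `f ∈ L²` as an element of `L⁴`, or zero if it does not belong to `L⁴`. -/
noncomputable def toL4 (f : Lp ℝ 2 m) : Lp ℝ 4 m :=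
  if h : MemLp f 4 m then h.toLp f else 0

theorem coeFn_toL4 {f : Lp ℝ 2 m} (h : MemLp f 4 m) : toL4 f =ᵐ[m] f := by
  rw [toL4, dif_pos h]
  exact h.coeFn_toLp

/-- The square of a function of `L²` belonging to `L⁴`, as an element of `L²`. -/
noncomputable def sqL4 (f : Lp ℝ 2 m) : Lp ℝ 2 m := mulL4 m (toL4 f) (toL4 f)

theorem coeFn_sqL4 {f : Lp ℝ 2 m} (h : MemLp f 4 m) : sqL4 f =ᵐ[m] fun x => (f x) ^ 2 := by
  filter_upwards [coeFn_mulL4 (toL4 f) (toL4 f), coeFn_toL4 h] with x h1 h2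
  rw [sqL4, h1, h2, pow_two]

variable (m) in
/-- The inclusion of `L⁴` into `L²`. -/
noncomputable def inclL4 [IsFiniteMeasure m] : Lp ℝ 4 m →L[ℝ] Lp ℝ 2 m :=
  (mulL4 m).flip ((memLp_const 1).toLp fun _ => (1 : ℝ))

theorem coeFn_inclL4 [IsFiniteMeasure m] (f : Lp ℝ 4 m) : inclL4 m f =ᵐ[m] f := by
  filter_upwards [coeFn_mulL4 f ((memLp_const 1).toLp fun _ => (1 : ℝ)),
    (memLp_const (1 : ℝ) (μ := m) (p := 4)).coeFn_toLp] with x h1 h2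
  rw [inclL4, ContinuousLinearMap.flip_apply, h1, h2, mul_one]

theorem inclL4_injective [IsFiniteMeasure m] : Function.Injective (inclL4 m) := fun f g h => by
  refine Lp.ext ((coeFn_inclL4 f).symm.trans ?_)
  rw [h]
  exact coeFn_inclL4 g

theorem inclL4_toL4 [IsFiniteMeasure m] {f : Lp ℝ 2 m} (h : MemLp f 4 m) :
    inclL4 m (toL4 f) = f :=
  Lp.ext ((coeFn_inclL4 _).trans (coeFn_toL4 h))

variable {𝕍 : Type*} [NormedAddCommGroup 𝕍] [InnerProductSpace ℝ 𝕍]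
  {ι : 𝕍 →L[ℝ] Lp ℝ 2 m} {E : 𝕍 →L[ℝ] 𝕍 →L[ℝ] ℝ}

theorem schrodingerForm_self_eq {u : 𝕍} (hu : MemLp (ι u) 4 m) (V : Lp ℝ 2 m) :
    schrodingerForm ι E V u u = E u u + ⟪sqL4 (ι u), V⟫ := by
  rw [schrodingerForm, L2.inner_def]
  congr 1
  refine integral_congr_ae ?_
  filter_upwards [coeFn_sqL4 hu] with x hx
  rw [hx, RCLike.inner_apply, conj_trivial, pow_two]

/-- The integrand is dominated by the product of `V` and `u²`, both in `L²`. Thus eigenfunctions of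
one potential are competitors for every other. -/
theorem mem_formDomain_of_memLp {u : 𝕍} (hu : MemLp (ι u) 4 m) (V : Lp ℝ 2 m) :
    u ∈ formDomain ι V := by
  have h : Integrable (fun x => V x * sqL4 (ι u) x) m :=
    (Lp.memLp V).integrable_mul (Lp.memLp (sqL4 (ι u)))
  refine Integrable.mono' h.norm (by fun_prop) ?_
  filter_upwards [coeFn_sqL4 hu] with x hx
  rw [norm_mul, norm_mul, hx]
  refine mul_le_mul_of_nonneg_right ?_ (norm_nonneg _)
  rw [Real.norm_of_nonneg (le_max_right _ _)]
  exact max_le (le_abs_self _) (abs_nonneg _)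

end SquareL4

/-! ### Eigenfunctions and Ky Fan inequalities for Schrödinger forms -/

section EigenSystems

open Module

variable {D : Type*} [MeasurableSpace D] {m : Measure D}
  {𝕍 : Type*} [NormedAddCommGroup 𝕍] [InnerProductSpace ℝ 𝕍]
  {ι : 𝕍 →L[ℝ] Lp ℝ 2 m} {E : 𝕍 →L[ℝ] 𝕍 →L[ℝ] ℝ} {α M : ℝ} {V : Lp ℝ 2 m} {b : ℝ} {J : ℕ}

theorem orthonormal_of_mem_eigenSystems {u : Fin J → 𝕍} (hu : u ∈ eigenSystems ι E J V) :
    Orthonormal ℝ fun i => ι (u i) :=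
  ⟨fun i => (hu.1 i).2, fun i j hij => hu.2 i j hij⟩

theorem exists_orthonormal_lift (hι : Function.Injective ι) {w : Fin J → 𝕍}
    (hw : Orthonormal ℝ fun i => ι (w i)) (hd : ∀ i, w i ∈ formDomain ι V) :
    ∃ x : Fin J → FormSpace ι V, Orthonormal ℝ x ∧ (fun i => formLift hι V (x i)) = w := by
  choose x hx using fun i => exists_formLift_eq ι V hι (hd i)
  refine ⟨x, ?_, funext hx⟩
  simp only [← hx, embed_formLift] at hw
  exact (orthonormal_iff_ite.2 fun i j => orthonormal_iff_ite.1 hw i j)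

theorem le_liftedForm (hE : IsCoerciveForm ι E α M) (hb : ∀ᵐ x ∂m, b ≤ V x)
    (x : FormSpace ι V) :
    (α + b) * ‖x‖ ^ 2 ≤ liftedForm hE.injective E hE.symm hb x x := by
  have h1 := le_schrodingerForm (E := E) hb (formLift_mem hE.injective x)
  have h2 := hE.lower (formLift hE.injective V x)
  rw [norm_embed_formLift] at h1 h2
  rw [liftedForm_apply]
  linarith

/-- The family `w` only certifies that the form domain has dimension at least `J`; compact sublevels
do the rest. -/
theorem exists_mem_eigenSystems [CompleteSpace 𝕍] (hE : IsCoerciveForm ι E α M)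
    (hb : ∀ᵐ x ∂m, b ≤ V x) {w : Fin J → 𝕍} (hw : Orthonormal ℝ fun i => ι (w i))
    (hd : ∀ i, w i ∈ formDomain ι V) : ∃ u, u ∈ eigenSystems ι E J V := by
  obtain ⟨x, hx, -⟩ := exists_orthonormal_lift hE.injective hw hd
  obtain ⟨y, hy⟩ := exists_isEigenSystem (liftedForm_comm hE.injective hE.symm hb)
    (le_liftedForm hE hb) (isCompact_sublevel_liftedForm hE hb) J
    ((finrank_span_eq_card hx.linearIndependent).trans (Fintype.card_fin J)).ge
  exact ⟨_, (isEigenSystem_liftedForm_iff hE.injective hE.symm hb).1 hy⟩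

theorem exists_isEigenSystem_lift (hE : IsCoerciveForm ι E α M) (hb : ∀ᵐ x ∂m, b ≤ V x)
    {u : Fin J → 𝕍} (hu : u ∈ eigenSystems ι E J V) : ∃ x : Fin J → FormSpace ι V,
      IsEigenSystem (liftedForm hE.injective E hE.symm hb) x ∧
        (fun i => formLift hE.injective V (x i)) = u := by
  obtain ⟨x, -, rfl⟩ := exists_orthonormal_lift hE.injective (orthonormal_of_mem_eigenSystems hu)
    fun i => (hu.1 i).1.1
  exact ⟨x, (isEigenSystem_liftedForm_iff hE.injective hE.symm hb).2 hu, rfl⟩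

theorem eigenvalueVec_mem_orderedVectors (hE : IsCoerciveForm ι E α M) (hb : ∀ᵐ x ∂m, b ≤ V x)
    {u : Fin J → 𝕍} (hu : u ∈ eigenSystems ι E J V) :
    eigenvalueVec ι E J V ∈ orderedVectors J (α + b) := by
  obtain ⟨x, hx, -⟩ := exists_isEigenSystem_lift hE hb hu
  have h : ∀ i : Fin J, eigenvalueVec ι E J V i =
      minmax (liftedForm hE.injective E hE.symm hb) (i + 1) := fun i =>
    (minmax_liftedForm hE.injective hE.symm hb _).symm
  refine ⟨fun i => ?_, fun i j hij => ?_⟩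
  · rw [h]
    exact hx.le_minmax (le_liftedForm hE hb) i
  · rw [h, h]
    exact hx.minmax_mono (liftedForm_comm hE.injective hE.symm hb) (le_liftedForm hE hb) hij

theorem sum_eigenvalueVec_eq {u : Fin J → 𝕍} (hu : u ∈ eigenSystems ι E J V) (s : Finset (Fin J)) :
    ∑ h ∈ s, schrodingerForm ι E V (u h) (u h) = ∑ h ∈ s, eigenvalueVec ι E J V h := by
  refine Finset.sum_congr rfl fun h _ => ?_
  rw [(hu.1 h).1.2.2 _ (hu.1 h).1.1, real_inner_self_eq_norm_sq, (hu.1 h).2]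
  simp

theorem sum_eigenvalueVec_le (hE : IsCoerciveForm ι E α M) (hb : ∀ᵐ x ∂m, b ≤ V x)
    {u : Fin J → 𝕍} (hu : u ∈ eigenSystems ι E J V) {w : Fin J → 𝕍}
    (hw : Orthonormal ℝ fun i => ι (w i)) (hd : ∀ i, w i ∈ formDomain ι V) (k : Fin J) :
    ∑ h ∈ Finset.Iic k, eigenvalueVec ι E J V h ≤
      ∑ h ∈ Finset.Iic k, schrodingerForm ι E V (w h) (w h) := by
  obtain ⟨x, hx, rfl⟩ := exists_isEigenSystem_lift hE hb hu
  obtain ⟨y, hy, rfl⟩ := exists_orthonormal_lift hE.injective hw hd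
  have h := hx.sum_minmax_le (liftedForm_comm hE.injective hE.symm hb) (le_liftedForm hE hb) k
    -- This choice of `ν` makes the coefficient of the remainder zero; the next eigenvalue would
    -- give the spectral gap instead.
    (ν := minmax (liftedForm hE.injective E hE.symm hb) (k + 1))
    (fun v hv => hx.minmax_mul_le (liftedForm_comm hE.injective hE.symm hb) (le_liftedForm hE hb)
      k k.2.le v fun i hi => hv i (Fin.le_def.2 hi.le)) hy
  simpa only [sub_self, zero_mul, add_zero, minmax_liftedForm, liftedForm_apply,
    eigenvalueVec] using h

theorem sum_eigenvalueVec_add_le (hE : IsCoerciveForm ι E α M) (hb : ∀ᵐ x ∂m, b ≤ V x)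
    {u : Fin J → 𝕍} (hu : u ∈ eigenSystems ι E J V) {w : Fin J → 𝕍}
    (hw : Orthonormal ℝ fun i => ι (w i)) (hd : ∀ i, w i ∈ formDomain ι V) {k l : Fin J}
    (hkl : (k : ℕ) + 1 = l) :
    ∑ h ∈ Finset.Iic k, eigenvalueVec ι E J V h +
        (eigenvalueVec ι E J V l - eigenvalueVec ι E J V k) *
          ∑ h ∈ Finset.Iic k, ‖ι (w h) - ∑ i ∈ Finset.Iic k, ⟪ι (u i), ι (w h)⟫ • ι (u i)‖ ^ 2 ≤
      ∑ h ∈ Finset.Iic k, schrodingerForm ι E V (w h) (w h) := by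
  obtain ⟨x, hx, rfl⟩ := exists_isEigenSystem_lift hE hb hu
  obtain ⟨y, hy, rfl⟩ := exists_orthonormal_lift hE.injective hw hd
  have h := hx.sum_minmax_le (liftedForm_comm hE.injective hE.symm hb) (le_liftedForm hE hb) k
    (ν := minmax (liftedForm hE.injective E hE.symm hb) (l + 1))
    (fun v hv => hx.minmax_mul_le (liftedForm_comm hE.injective hE.symm hb) (le_liftedForm hE hb)
      l l.2.le v fun i hi => hv i (Fin.le_def.2 (by omega))) hy
  have hn : ∀ h, ‖y h - ∑ i ∈ Finset.Iic k, ⟪x i, y h⟫ • x i‖ =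
      ‖(y h : Lp ℝ 2 m) - ∑ i ∈ Finset.Iic k, ⟪(x i : Lp ℝ 2 m), y h⟫ • (x i : Lp ℝ 2 m)‖ := by
    intro h
    calc _ = ‖((y h - ∑ i ∈ Finset.Iic k, ⟪x i, y h⟫ • x i : FormSpace ι V) : Lp ℝ 2 m)‖ := rfl
      _ = _ := by
        congr 1
        simp
  simp only [minmax_liftedForm, liftedForm_apply, hn] at h
  simpa only [embed_formLift, eigenvalueVec] using h

end EigenSystems

/-- For a square matrix `C * Cᵀ = 1` yields `Cᵀ * C = 1`, so the mixed terms cancel. With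
multiplication as `B`, sums of squares do not depend on the orthonormal basis. -/
theorem sum_bilin_eq_of_orthogonal {κ X Y : Type*} [Fintype κ] [DecidableEq κ] [AddCommGroup X]
    [Module ℝ X] [AddCommGroup Y] [Module ℝ Y] (B : X →ₗ[ℝ] X →ₗ[ℝ] Y) {a u : κ → X}
    {C : Matrix κ κ ℝ} (hC : C * C.transpose = 1) (ha : ∀ h, a h = ∑ l, C h l • u l) :
    ∑ h, B (a h) (a h) = ∑ l, B (u l) (u l) := by
  have hC' : C.transpose * C = 1 := mul_eq_one_comm.1 hC
  have h1 : ∀ h, B (a h) (a h) = ∑ l, ∑ l', (C h l * C h l') • B (u l) (u l') := by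
    intro h
    simp only [ha, map_sum, map_smul, LinearMap.sum_apply, LinearMap.smul_apply, Finset.smul_sum,
      smul_smul]
    rw [Finset.sum_comm]
    exact Finset.sum_congr rfl fun l _ => Finset.sum_congr rfl fun l' _ => by rw [mul_comm]
  simp only [h1]
  rw [Finset.sum_comm]
  refine Finset.sum_congr rfl fun l _ => ?_
  rw [Finset.sum_comm]
  have h2 : ∀ l', ∑ h, (C h l * C h l') • B (u l) (u l') =
      (if l = l' then (1 : ℝ) else 0) • B (u l) (u l') := by
    intro l'
    rw [← Finset.sum_smul, ← Matrix.one_apply, ← hC', Matrix.mul_apply]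
    rfl
  simp [h2]


/-! ### The functions `σ_{k,c}` and convergence of their slopes -/

section LevelSets

variable {D : Type*} [MeasurableSpace D] {m : Measure D}
  {𝕍 : Type*} [NormedAddCommGroup 𝕍] [InnerProductSpace ℝ 𝕍]
  {ι : 𝕍 →L[ℝ] Lp ℝ 2 m} {E : 𝕍 →L[ℝ] 𝕍 →L[ℝ] ℝ} {α M : ℝ}
  {𝒦 : Lp ℝ 2 m → EReal} {θ Vmin c : ℝ} {J : ℕ}

variable (E) in
/-- The potential-free part of the energy of the first `k + 1` functions of a system. -/
noncomputable def energySum (k : Fin J) (w : Fin J → 𝕍) : ℝ :=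
  ∑ h ∈ Finset.Iic k, E (w h) (w h)

variable (ι) in
/-- The sum of the squares of the first `k + 1` functions of a system. -/
noncomputable def squareSum (k : Fin J) (w : Fin J → 𝕍) : Lp ℝ 2 m :=
  ∑ h ∈ Finset.Iic k, sqL4 (ι (w h))

theorem sum_schrodingerForm_eq {w : Fin J → 𝕍} (hw : ∀ h, MemLp (ι (w h)) 4 m) (V : Lp ℝ 2 m)
    (k : Fin J) : ∑ h ∈ Finset.Iic k, schrodingerForm ι E V (w h) (w h) =
      energySum E k w + ⟪squareSum ι k w, V⟫ := by
  simp only [schrodingerForm_self_eq (hw _), Finset.sum_add_distrib, energySum, squareSum,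
    sum_inner]

theorem energySum_nonneg (hE : IsCoerciveForm ι E α M) (k : Fin J) (w : Fin J → 𝕍) :
    0 ≤ energySum E k w :=
  Finset.sum_nonneg fun _ _ => (mul_nonneg hE.alpha_nonneg (sq_nonneg _)).trans (hE.lower _)

theorem EigenfunctionsL4.memLp_system {lamMin : ℝ} (h4 : EigenfunctionsL4 ι E 𝒦 θ lamMin)
    {V : Lp ℝ 2 m} (hV : V ∈ admissible 𝒦) {u : Fin J → 𝕍} (hu : u ∈ eigenSystems ι E J V)
    (h : Fin J) : MemLp (ι (u h)) 4 m :=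
  h4.memLp V hV _ _ (hu.1 h).1

theorem EigenfunctionsL4.memLp_level {lamMin : ℝ} (h4 : EigenfunctionsL4 ι E 𝒦 θ lamMin)
    {w : Fin J → 𝕍} (hw : w ∈ eigenSystemsLevel ι E 𝒦 θ J c) (h : Fin J) :
    MemLp (ι (w h)) 4 m := by
  obtain ⟨V, hV, hw⟩ := hw
  exact h4.memLp_system hV.1 hw h

theorem orthonormal_of_mem_eigenSystemsLevel {w : Fin J → 𝕍}
    (hw : w ∈ eigenSystemsLevel ι E 𝒦 θ J c) : Orthonormal ℝ fun i => ι (w i) := by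
  obtain ⟨V, -, hw⟩ := hw
  exact orthonormal_of_mem_eigenSystems hw

theorem sigmaLevel_eq_infAffine {lamMin : ℝ} (h4 : EigenfunctionsL4 ι E 𝒦 θ lamMin) (k : Fin J)
    (W : Lp ℝ 2 m) : sigmaLevel ι E 𝒦 θ J c k W =
      infAffine (eigenSystemsLevel ι E 𝒦 θ J c) (energySum E k) (squareSum ι k) W := by
  rw [sigmaLevel, infAffine]
  congr 1
  exact image_congr fun w hw => sum_schrodingerForm_eq (h4.memLp_level hw) W k

theorem sum_eigenvalueVec_eq_add {lamMin : ℝ} (h4 : EigenfunctionsL4 ι E 𝒦 θ lamMin)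
    {V : Lp ℝ 2 m} (hV : V ∈ admissible 𝒦) {u : Fin J → 𝕍} (hu : u ∈ eigenSystems ι E J V)
    (k : Fin J) : ∑ h ∈ Finset.Iic k, eigenvalueVec ι E J V h =
      energySum E k u + ⟪squareSum ι k u, V⟫ := by
  rw [← sum_eigenvalueVec_eq hu, sum_schrodingerForm_eq (h4.memLp_system hV hu)]

/-- Ky Fan bounds every competitor from below, and `u` is itself a competitor attaining the bound,
since `V` belongs to the level. -/
theorem sigmaLevel_eq_sum (hE : IsCoerciveForm ι E α M) (h𝒦 : IsPotentialFunctional 𝒦 θ Vmin)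
    (h4 : EigenfunctionsL4 ι E 𝒦 θ (α + Vmin)) {V : Lp ℝ 2 m} (hV : V ∈ admissibleLevel 𝒦 θ c)
    {u : Fin J → 𝕍} (hu : u ∈ eigenSystems ι E J V) (k : Fin J) :
    sigmaLevel ι E 𝒦 θ J c k V = ∑ h ∈ Finset.Iic k, eigenvalueVec ι E J V h := by
  have hle : ∀ r ∈ (fun w : Fin J → 𝕍 => ∑ h ∈ Finset.Iic k, schrodingerForm ι E V (w h) (w h)) ''
      eigenSystemsLevel ι E 𝒦 θ J c, ∑ h ∈ Finset.Iic k, eigenvalueVec ι E J V h ≤ r := by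
    rintro _ ⟨w, hw, rfl⟩
    exact sum_eigenvalueVec_le hE (h𝒦.lower_bound V hV.1) hu
      (orthonormal_of_mem_eigenSystemsLevel hw)
      (fun i => mem_formDomain_of_memLp (h4.memLp_level hw i) V) k
  have hu' : u ∈ eigenSystemsLevel ι E 𝒦 θ J c := ⟨V, hV, hu⟩
  refine le_antisymm ?_ (le_csInf ⟨_, u, hu', rfl⟩ hle)
  exact csInf_le ⟨_, hle⟩ ⟨u, hu', sum_eigenvalueVec_eq hu _⟩

theorem increments_sigmaLevel (hE : IsCoerciveForm ι E α M)
    (h𝒦 : IsPotentialFunctional 𝒦 θ Vmin) (h4 : EigenfunctionsL4 ι E 𝒦 θ (α + Vmin))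
    {V : Lp ℝ 2 m} (hV : V ∈ admissibleLevel 𝒦 θ c) {u : Fin J → 𝕍}
    (hu : u ∈ eigenSystems ι E J V) :
    (increments fun k => sigmaLevel ι E 𝒦 θ J c k V) = eigenvalueVec ι E J V := by
  simp only [sigmaLevel_eq_sum hE h𝒦 h4 hV hu]
  exact increments_sum_Iic _

theorem nonempty_eigenSystems [CompleteSpace 𝕍] (hE : IsCoerciveForm ι E α M)
    (h𝒦 : IsPotentialFunctional 𝒦 θ Vmin) (h4 : EigenfunctionsL4 ι E 𝒦 θ (α + Vmin))
    {V W : Lp ℝ 2 m} (hV : V ∈ admissible 𝒦) (hW : W ∈ admissible 𝒦) {u : Fin J → 𝕍}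
    (hu : u ∈ eigenSystems ι E J V) : ∃ w, w ∈ eigenSystems ι E J W :=
  exists_mem_eigenSystems hE (h𝒦.lower_bound W hW) (orthonormal_of_mem_eigenSystems hu)
    fun i => mem_formDomain_of_memLp (h4.memLp_system hV hu i) W

theorem exists_eigenvalueVec_le [CompleteSpace 𝕍] (hE : IsCoerciveForm ι E α M)
    (h𝒦 : IsPotentialFunctional 𝒦 θ Vmin) (h4 : EigenfunctionsL4 ι E 𝒦 θ (α + Vmin))
    {V : Lp ℝ 2 m} (hV : V ∈ admissible 𝒦) {u : Fin J → 𝕍} (hu : u ∈ eigenSystems ι E J V)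
    (c : ℝ) : ∃ Λ, ∀ W ∈ admissibleLevel 𝒦 θ c, ∀ i, eigenvalueVec ι E J W i ≤ Λ := by
  have key : ∀ i : Fin J, ∃ Λ, ∀ W ∈ admissibleLevel 𝒦 θ c, eigenvalueVec ι E J W i ≤ Λ := by
    intro i
    -- The fixed system `u` tests every `W`, which bounds the partial sum. Eigenvalues may be
    -- negative but are at least `α + Vmin`; the last sum compensates for isolating one of them.
    refine ⟨energySum E i u + ‖squareSum ι i u‖ * c +
      ∑ _h ∈ Finset.Iic i, |α + Vmin|, fun W hW => ?_⟩
    obtain ⟨w, hw⟩ := nonempty_eigenSystems hE h𝒦 h4 hV hW.1 hu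
    have hm := eigenvalueVec_mem_orderedVectors hE (h𝒦.lower_bound W hW.1) hw
    have h1 := sum_eigenvalueVec_le hE (h𝒦.lower_bound W hW.1) hw
      (orthonormal_of_mem_eigenSystems hu)
      (fun i => mem_formDomain_of_memLp (h4.memLp_system hV hu i) W) i
    rw [sum_schrodingerForm_eq (h4.memLp_system hV hu)] at h1
    have h2 := real_inner_le_norm (squareSum ι i u) W
    have h3 := mul_le_mul_of_nonneg_left hW.2.1 (norm_nonneg (squareSum ι i u))
    have h4 := Finset.single_le_sum (f := fun h => eigenvalueVec ι E J W h + |α + Vmin|)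
      (fun h _ => by linarith [hm.1 h, neg_abs_le (α + Vmin)]) (Finset.mem_Iic.2 (le_refl i))
    rw [Finset.sum_add_distrib] at h4
    linarith [abs_nonneg (α + Vmin)]
  choose Λ hΛ using key
  exact ⟨∑ i, |Λ i|, fun W hW i => (hΛ i W hW).trans ((le_abs_self _).trans
    (Finset.single_le_sum (f := fun i => |Λ i|) (fun _ _ => abs_nonneg _) (Finset.mem_univ i)))⟩

theorem eigenvalueVec_le_maxEigenvalue [CompleteSpace 𝕍] (hE : IsCoerciveForm ι E α M)
    (h𝒦 : IsPotentialFunctional 𝒦 θ Vmin) (h4 : EigenfunctionsL4 ι E 𝒦 θ (α + Vmin))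
    {V : Lp ℝ 2 m} (hV : V ∈ admissibleLevel 𝒦 θ c) {u : Fin J → 𝕍}
    (hu : u ∈ eigenSystems ι E J V) (i : Fin J) :
    eigenvalueVec ι E J V i ≤ maxEigenvalue ι E 𝒦 θ J c := by
  obtain ⟨Λ, hΛ⟩ := exists_eigenvalueVec_le hE h𝒦 h4 hV.1 hu c
  have hi := i.2
  have hlast : ∀ W, eigenvalueVec ι E J W ⟨J - 1, by omega⟩ = eigenvalue ι E W J := fun W => by
    rw [eigenvalueVec]
    congr 1
    exact Nat.sub_add_cancel (by omega)
  refine ((eigenvalueVec_mem_orderedVectors hE (h𝒦.lower_bound V hV.1) hu).2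
    (show i ≤ ⟨J - 1, by omega⟩ from Fin.le_def.2 (by simp only; omega))).trans ?_
  rw [hlast]
  refine le_csSup ⟨Λ, ?_⟩ ⟨V, hV, rfl⟩
  rintro _ ⟨W, hW, rfl⟩
  exact (hlast W).symm.trans_le (hΛ W hW _)

theorem exists_isCompact_toL4_mem [CompleteSpace 𝕍] (hE : IsCoerciveForm ι E α M)
    (h𝒦 : IsPotentialFunctional 𝒦 θ Vmin) (h4 : EigenfunctionsL4 ι E 𝒦 θ (α + Vmin))
    {V : Lp ℝ 2 m} (hV : V ∈ admissible 𝒦) {u : Fin J → 𝕍} (hu : u ∈ eigenSystems ι E J V)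
    (c : ℝ) : ∃ K : Set (Lp ℝ 4 m), IsCompact K ∧
      ∀ w ∈ eigenSystemsLevel ι E 𝒦 θ J c, ∀ h, toL4 (ι (w h)) ∈ K := by
  obtain ⟨Λ, hΛ⟩ := exists_eigenvalueVec_le hE h𝒦 h4 hV hu c
  -- The maximum ensures that the threshold exceeds `α + Vmin`, as the compactness assumption
  -- demands.
  refine ⟨_, h4.relCompact c (max Λ (α + Vmin + 1)) (lt_max_of_lt_right (by linarith)), ?_⟩
  rintro w ⟨W, hW, hw⟩ h
  exact subset_closure ⟨W, hW, _, (hΛ W hW h).trans (le_max_left _ _), w h, hw.1 h,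
    coeFn_toL4 (h4.memLp_system hW.1 hw h)⟩

theorem exists_norm_squareSum_le {K : Set (Lp ℝ 4 m)} (hK : IsCompact K) {U : Set (Fin J → 𝕍)}
    (hKU : ∀ w ∈ U, ∀ h, toL4 (ι (w h)) ∈ K) :
    ∃ C, 0 ≤ C ∧ ∀ w ∈ U, ∀ k, ‖squareSum ι k w‖ ≤ C := by
  have hc : Continuous fun f : Lp ℝ 4 m => mulL4 m f f := by fun_prop
  obtain ⟨R, hR⟩ := (hK.image hc).isBounded.exists_norm_le
  refine ⟨∑ _h : Fin J, |R|, Finset.sum_nonneg fun _ _ => abs_nonneg _, fun w hw k => ?_⟩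
  refine (norm_sum_le _ _).trans ((Finset.sum_le_sum fun h _ => ?_).trans
    (Finset.sum_le_sum_of_subset_of_nonneg (Finset.subset_univ _) fun _ _ _ => abs_nonneg _))
  exact (hR _ ⟨_, hKU w hw h, rfl⟩).trans (le_abs_self _)

/-- Two orthonormal bases of the same finite-dimensional space of functions have the same sum of
squares. -/
theorem squareSum_eq_of_mem_span [IsFiniteMeasure m] {u : Fin J → 𝕍}
    (hu4 : ∀ h, MemLp (ι (u h)) 4 m) (hu : Orthonormal ℝ fun i => ι (u i)) {a : Fin J → Lp ℝ 4 m}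
    (hon : ∀ h h', ⟪inclL4 m (a h), inclL4 m (a h')⟫ = if h = h' then 1 else 0) {k : Fin J}
    (hspan : ∀ h ∈ Finset.Iic k, inclL4 m (a h) =
      ∑ i ∈ Finset.Iic k, ⟪ι (u i), inclL4 m (a h)⟫ • ι (u i)) :
    squareSum ι k u = ∑ h ∈ Finset.Iic k, mulL4 m (a h) (a h) := by
  let C : Matrix (Finset.Iic k) (Finset.Iic k) ℝ := fun h i => ⟪ι (u i), inclL4 m (a h)⟫
  have hC : C * C.transpose = 1 := by
    ext h h'
    have h1 : ⟪inclL4 m (a h), inclL4 m (a h')⟫ = (1 : Matrix (Finset.Iic k) (Finset.Iic k) ℝ) h h' := by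
      rw [hon, Matrix.one_apply]
      simp only [Subtype.ext_iff]
    rw [Matrix.mul_apply, ← h1, hspan h h.2, hspan h' h'.2, hu.inner_sum]
    simp only [conj_trivial]
    exact Finset.sum_coe_sort (Finset.Iic k)
      fun i => ⟪ι (u i), inclL4 m (a h)⟫ * ⟪ι (u i), inclL4 m (a h')⟫
  -- The expansion is lifted from `L²` to `L⁴`, where multiplication is bilinear with values in
  -- `L²`.
  have hmul : ∀ h : Finset.Iic k, a h = ∑ i, C h i • toL4 (ι (u (i : Fin J))) := fun h => by
    refine inclL4_injective ?_
    rw [hspan h h.2, map_sum, ← Finset.sum_coe_sort]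
    refine Finset.sum_congr rfl fun i _ => ?_
    rw [map_smul, inclL4_toL4 (hu4 i)]
  let B : Lp ℝ 4 m →ₗ[ℝ] Lp ℝ 4 m →ₗ[ℝ] Lp ℝ 2 m :=
    ContinuousLinearMap.coeLM ℝ ∘ₗ (mulL4 m).toLinearMap
  have h2 := sum_bilin_eq_of_orthogonal B (a := fun h : Finset.Iic k => a h) hC hmul
  have h3 := Finset.sum_coe_sort (Finset.Iic k) fun h => B (a h) (a h)
  have h4 := Finset.sum_coe_sort (Finset.Iic k) fun h => B (toL4 (ι (u h))) (toL4 (ι (u h)))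
  exact h4.symm.trans (h2.symm.trans h3)

/-- If the eigenvalues `λ_k(V) < λ_{k+1}(V)` are separated, then the sums of squares of almost
minimizing systems converge to the one of the eigenfunctions of `V`. -/
theorem tendsto_squareSum [IsFiniteMeasure m] (hE : IsCoerciveForm ι E α M)
    {V : Lp ℝ 2 m} {b : ℝ} (hb : ∀ᵐ x ∂m, b ≤ V x) {u : Fin J → 𝕍}
    (hu : u ∈ eigenSystems ι E J V) (hu4 : ∀ h, MemLp (ι (u h)) 4 m) {U : Set (Fin J → 𝕍)}
    (hU4 : ∀ w ∈ U, ∀ h, MemLp (ι (w h)) 4 m) (hUon : ∀ w ∈ U, Orthonormal ℝ fun i => ι (w i))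
    {K : Set (Lp ℝ 4 m)} (hK : IsCompact K) (hKU : ∀ w ∈ U, ∀ h, toL4 (ι (w h)) ∈ K)
    {k l : Fin J} (hkl : (k : ℕ) + 1 = l)
    (hgap : eigenvalueVec ι E J V k < eigenvalueVec ι E J V l) :
    Tendsto (squareSum ι k) (comap (fun w => energySum E k w + ⟪squareSum ι k w, V⟫)
      (𝓝 (∑ h ∈ Finset.Iic k, eigenvalueVec ι E J V h)) ⊓ 𝓟 U) (𝓝 (squareSum ι k u)) := by
  rw [tendsto_iff_ultrafilter]
  intro g hg
  have hgU : ∀ᶠ w in g, w ∈ U := le_principal_iff.1 (hg.trans inf_le_right)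
  have hgE : Tendsto (fun w => energySum E k w + ⟪squareSum ι k w, V⟫) g
      (𝓝 (∑ h ∈ Finset.Iic k, eigenvalueVec ι E J V h)) :=
    tendsto_iff_comap.2 (hg.trans inf_le_left)
  have hconv : ∀ h, ∃ a : Lp ℝ 4 m, 
      Tendsto (fun w : Fin J → 𝕍 => toL4 (ι (w h))) g (𝓝 a) := fun h => by
    obtain ⟨a, -, ha⟩ := hK.ultrafilter_le_nhds' 
      (Ultrafilter.map (fun w : Fin J → 𝕍 => toL4 (ι (w h))) g)
      (Ultrafilter.mem_map.2 (mem_of_superset hgU fun w hw => hKU w hw h))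
    exact ⟨a, ha⟩
  choose a ha using hconv
  have hy : ∀ h, Tendsto (fun w : Fin J → 𝕍 => ι (w h)) g (𝓝 (inclL4 m (a h))) := fun h => by
    refine (((inclL4 m).continuous.tendsto (a h)).comp (ha h)).congr' ?_
    filter_upwards [hgU] with w hw
    exact inclL4_toL4 (hU4 w hw h)
  have hu' := orthonormal_of_mem_eigenSystems hu
  have hon : ∀ h h', ⟪inclL4 m (a h), inclL4 m (a h')⟫ = if h = h' then 1 else 0 := fun h h' => by
    refine tendsto_nhds_unique ((hy h).inner (hy h')) (tendsto_const_nhds.congr' ?_)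
    filter_upwards [hgU] with w hw
    exact (orthonormal_iff_ite.1 (hUon w hw) h h').symm
  -- The total squared distance to the span of the first eigenfunctions: continuous in `L²`, and at
  -- most the energy excess divided by the gap, hence zero in the limit.
  let r : (Fin J → Lp ℝ 2 m) → ℝ := fun f => ∑ h ∈ Finset.Iic k,
    ‖f h - ∑ i ∈ Finset.Iic k, ⟪ι (u i), f h⟫ • ι (u i)‖ ^ 2
  have hr : Continuous r := by fun_prop
  have hrlim : Tendsto (fun w : Fin J → 𝕍 => r fun h => ι (w h)) g
      (𝓝 (r fun h => inclL4 m (a h))) :=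
    (hr.tendsto _).comp (tendsto_pi_nhds.2 hy)
  have hr0 : Tendsto (fun w : Fin J → 𝕍 => r fun h => ι (w h)) g (𝓝 0) := by
    have hup : Tendsto (fun w => (energySum E k w + ⟪squareSum ι k w, V⟫ -
        ∑ h ∈ Finset.Iic k, eigenvalueVec ι E J V h) /
          (eigenvalueVec ι E J V l - eigenvalueVec ι E J V k)) g (𝓝 0) := by
      simpa using (hgE.sub_const (∑ h ∈ Finset.Iic k, eigenvalueVec ι E J V h)).div_const
        (eigenvalueVec ι E J V l - eigenvalueVec ι E J V k)
    refine tendsto_of_tendsto_of_tendsto_of_le_of_le' tendsto_const_nhds hup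
      (Eventually.of_forall fun w => Finset.sum_nonneg fun _ _ => sq_nonneg _) ?_
    filter_upwards [hgU] with w hw
    have h1 := sum_eigenvalueVec_add_le hE hb hu (hUon w hw)
      (fun i => mem_formDomain_of_memLp (hU4 w hw i) V) hkl
    rw [sum_schrodingerForm_eq (hU4 w hw)] at h1
    rw [le_div_iff₀ (sub_pos.2 hgap)]
    linarith
  have hzero := tendsto_nhds_unique hrlim hr0
  rw [Finset.sum_eq_zero_iff_of_nonneg fun _ _ => sq_nonneg _] at hzero
  have hspan : ∀ h ∈ Finset.Iic k, inclL4 m (a h) =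
      ∑ i ∈ Finset.Iic k, ⟪ι (u i), inclL4 m (a h)⟫ • ι (u i) := fun h hh =>
    sub_eq_zero.1 (norm_eq_zero.1 (pow_eq_zero_iff two_ne_zero |>.1 (hzero h hh)))
  rw [squareSum_eq_of_mem_span hu4 hu' hon hspan]
  have hc : Continuous fun f : Lp ℝ 4 m => mulL4 m f f := by fun_prop
  have hterm : ∀ h, Tendsto (fun w : Fin J → 𝕍 => sqL4 (ι (w h))) g (𝓝 (mulL4 m (a h) (a h))) :=
    fun h => (hc.tendsto (a h)).comp (ha h)
  exact tendsto_finsetSum (f := fun h (w : Fin J → 𝕍) => sqL4 (ι (w h))) (Finset.Iic k)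
    fun h _ => hterm h

end LevelSets

/-! ### Geometry of `Λ^J` and the structural condition -/

section OrderedVectors

variable {J : ℕ} {lamMin : ℝ}

theorem convex_orderedVectors : Convex ℝ (orderedVectors J lamMin) := by
  intro x hx y hy s t hs ht hst
  refine ⟨fun i => ?_, fun i j hij => ?_⟩
  · have h1 := mul_le_mul_of_nonneg_left (hx.1 i) hs
    have h2 := mul_le_mul_of_nonneg_left (hy.1 i) ht
    have h3 : lamMin = s * lamMin + t * lamMin := by rw [← add_mul, hst, one_mul]
    simp only [Pi.add_apply, Pi.smul_apply, smul_eq_mul]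
    linarith
  · have h1 := mul_le_mul_of_nonneg_left (hx.2 hij) hs
    have h2 := mul_le_mul_of_nonneg_left (hy.2 hij) ht
    simp only [Pi.add_apply, Pi.smul_apply, smul_eq_mul]
    linarith

theorem interior_orderedVectors_nonempty : (interior (orderedVectors J lamMin)).Nonempty := by
  -- Consecutive entries of the center differ by `1`, so perturbations smaller than `1 / 2` preserve
  -- the order.
  refine ⟨fun i => lamMin + 1 + (i : ℕ), mem_interior.2
    ⟨Metric.ball (fun i : Fin J => lamMin + 1 + ((i : ℕ) : ℝ)) (1 / 2), fun y hy => ?_,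
      Metric.isOpen_ball, Metric.mem_ball_self (by norm_num)⟩⟩
  have h : ∀ i, |y i - (lamMin + 1 + ((i : ℕ) : ℝ))| < 1 / 2 := fun i =>
    ((norm_le_pi_norm (y - fun i : Fin J => lamMin + 1 + ((i : ℕ) : ℝ)) i).trans_lt
      (mem_ball_iff_norm.1 hy))
  refine ⟨fun i => ?_, fun i j hij => ?_⟩
  · have h1 := (abs_lt.1 (h i)).1
    have h2 : (0 : ℝ) ≤ (i : ℕ) := Nat.cast_nonneg _
    linarith
  · rcases hij.eq_or_lt with rfl | hlt
    · exact le_rfl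
    · have h1 := (abs_lt.1 (h i)).2
      have h2 := (abs_lt.1 (h j)).1
      have h3 : ((i : ℕ) : ℝ) + 1 ≤ (j : ℕ) := by exact_mod_cast Fin.lt_def.1 hlt
      linarith

theorem uniqueDiffOn_orderedVectors : UniqueDiffOn ℝ (orderedVectors J lamMin) :=
  uniqueDiffOn_convex convex_orderedVectors interior_orderedVectors_nonempty

theorem StructuralCondition.decrements_nonneg_or {φ : (Fin J → ℝ) → ℝ}
    (h : StructuralCondition lamMin φ) {l : Fin J → ℝ} (hl : l ∈ orderedVectors J lamMin)
    (k : Fin J) : 0 ≤ decrements (fun i => partialDeriv lamMin φ i l) k ∨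
      ∃ j : Fin J, (k : ℕ) + 1 = j ∧ l k < l j := by
  rw [decrements]
  split_ifs with hk
  · rcases (hl.2 (show k ≤ ⟨k + 1, hk⟩ from Fin.le_def.2 (Nat.le_succ _))).eq_or_lt with heq | hlt
    · exact Or.inl (sub_nonneg.2 ((h l hl).2 k ⟨k + 1, hk⟩ rfl heq))
    · exact Or.inr ⟨_, rfl, hlt⟩
  · exact Or.inl (by simpa using (h l hl).1 k (by omega))

end OrderedVectors

/-- A lower limit in `EReal` is nonnegative as soon as each real `r < 0` is an eventual lower bound;
take `ε = -r`. -/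
theorem mem_frechetSuperdifferential {H : Type*} [NormedAddCommGroup H] [InnerProductSpace ℝ H]
    {G : H → ℝ} {v ξ : H}
    (h : ∀ ε > 0, ∀ᶠ w in 𝓝 v, G w - G v - ⟪ξ, w - v⟫ ≤ ε * ‖w - v‖) :
    ξ ∈ frechetSuperdifferential G v := by
  change (0 : EReal) ≤ liminf _ _
  refine le_of_forall_lt_imp_le_of_dense fun a ha => ?_
  obtain ⟨r, har, hr⟩ := EReal.lt_iff_exists_real_btwn.1 ha
  refine har.le.trans (le_liminf_of_le (by isBoundedDefault) ?_)
  have hr' : r < 0 := by exact_mod_cast hr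
  filter_upwards [(h (-r) (neg_pos.2 hr')).filter_mono nhdsWithin_le_nhds,
    self_mem_nhdsWithin] with w hw hne
  have hpos : 0 < ‖w - v‖ := norm_pos_iff.2 (sub_ne_zero.2 hne)
  rw [EReal.coe_le_coe_iff, le_div_iff₀ hpos, inner_neg_left]
  linarith


/-! ### The supergradient inequality -/

section Superdifferential

variable {D : Type*} [MeasurableSpace D] {m : Measure D}
  {𝕍 : Type*} [NormedAddCommGroup 𝕍] [InnerProductSpace ℝ 𝕍]
  {ι : 𝕍 →L[ℝ] Lp ℝ 2 m} {E : 𝕍 →L[ℝ] 𝕍 →L[ℝ] ℝ} {α M : ℝ}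
  {𝒦 : Lp ℝ 2 m → EReal} {θ Vmin c : ℝ} {J : ℕ}

variable (ι E) in
/-- The supergradient `∑ ∂_i φ(λ(V)) u_i²` as an element of `L²`. -/
noncomputable def spectralGradient (lamMin : ℝ) (φ : (Fin J → ℝ) → ℝ) (V : Lp ℝ 2 m)
    (u : Fin J → 𝕍) : Lp ℝ 2 m :=
  ∑ i, partialDeriv lamMin φ i (eigenvalueVec ι E J V) • sqL4 (ι (u i))

theorem coeFn_spectralGradient (lamMin : ℝ) (φ : (Fin J → ℝ) → ℝ) (V : Lp ℝ 2 m)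
    {u : Fin J → 𝕍} (hu : ∀ i, MemLp (ι (u i)) 4 m) :
    spectralGradient ι E lamMin φ V u =ᵐ[m] fun x =>
      ∑ i, partialDeriv lamMin φ i (eigenvalueVec ι E J V) * (ι (u i) x) ^ 2 := by
  have h1 := Lp.coeFn_finsetSum (p := 2) (μ := m) Finset.univ
    fun i => partialDeriv lamMin φ i (eigenvalueVec ι E J V) • sqL4 (ι (u i))
  filter_upwards [h1, ae_all_iff.2 fun i => coeFn_sqL4 (hu i), ae_all_iff.2 fun i =>
    Lp.coeFn_smul (partialDeriv lamMin φ i (eigenvalueVec ι E J V)) (sqL4 (ι (u i)))]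
    with x hx1 hx2 hx3
  rw [spectralGradient, hx1, Finset.sum_apply]
  refine Finset.sum_congr rfl fun i _ => ?_
  rw [hx3, Pi.smul_apply, hx2, smul_eq_mul]

/-- The superdifferential inequality for a function of the increments of the functions
`σ_{k,c}`, whose derivative at `λ(V)` agrees with the one of `φ`. -/
theorem eventually_comp_sigmaLevel_sub_le [IsFiniteMeasure m] [CompleteSpace 𝕍]
    (hE : IsCoerciveForm ι E α M) (h𝒦 : IsPotentialFunctional 𝒦 θ Vmin)
    (h4 : EigenfunctionsL4 ι E 𝒦 θ (α + Vmin)) {φ : (Fin J → ℝ) → ℝ}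
    (hstruct : StructuralCondition (α + Vmin) φ) {V : Lp ℝ 2 m}
    (hV : V ∈ admissibleLevel 𝒦 θ c) {u : Fin J → 𝕍} (hu : u ∈ eigenSystems ι E J V)
    {f : (Fin J → ℝ) → ℝ} {S : Set (Fin J → ℝ)} {T : Set (Lp ℝ 2 m)}
    (hf : HasFDerivWithinAt f (fderivWithin ℝ φ (orderedVectors J (α + Vmin))
      (eigenvalueVec ι E J V)) S (eigenvalueVec ι E J V))
    (hT : ∀ W ∈ T, (increments fun k => sigmaLevel ι E 𝒦 θ J c k W) ∈ S) {ε : ℝ} (hε : 0 < ε) :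
    ∀ᶠ W in 𝓝 V, W ∈ T → f (increments fun k => sigmaLevel ι E 𝒦 θ J c k W) -
      f (eigenvalueVec ι E J V) - ⟪spectralGradient ι E (α + Vmin) φ V u, W - V⟫
        ≤ ε * ‖W - V‖ := by
  have hb := h𝒦.lower_bound V hV.1
  have huU : u ∈ eigenSystemsLevel ι E 𝒦 θ J c := ⟨V, hV, hu⟩
  obtain ⟨K, hK, hKU⟩ := exists_isCompact_toL4_mem hE h𝒦 h4 hV.1 hu c
  obtain ⟨C, hC, hCU⟩ := exists_norm_squareSum_le hK hKU
  have he : ∀ k, ∀ w ∈ eigenSystemsLevel ι E 𝒦 θ J c, 0 ≤ energySum E k w :=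
    fun k w _ => energySum_nonneg hE k w
  have hq : ∀ k, ∀ w ∈ eigenSystemsLevel ι E 𝒦 θ J c, ‖squareSum ι k w‖ ≤ C :=
    fun k w hw => hCU w hw k
  have hσ := sigmaLevel_eq_infAffine (J := J) (c := c) h4
  have hinc := increments_sigmaLevel hE h𝒦 h4 hV hu
  have hval : ∀ k, infAffine (eigenSystemsLevel ι E 𝒦 θ J c) (energySum E k) (squareSum ι k) V =
      ∑ h ∈ Finset.Iic k, eigenvalueVec ι E J V h := fun k => by
    rw [← hσ, sigmaLevel_eq_sum hE h𝒦 h4 hV hu]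
  have hmain := eventually_comp_increments_sub_le
    (σ := fun k W => sigmaLevel ι E 𝒦 θ J c k W) (Q := fun k => squareSum ι k u) (V := V)
    (f := f) (L := fderivWithin ℝ φ (orderedVectors J (α + Vmin)) (eigenvalueVec ι E J V))
    (S := S) (T := T) hC
    (fun k W => by rw [hσ, hσ]; exact abs_infAffine_sub_le ⟨u, huU⟩ (he k) (hq k) V W)
    (fun k W => by
      rw [hσ, hσ]
      refine infAffine_sub_le (he k) (hq k) huU ?_ W
      rw [hval, sum_eigenvalueVec_eq_add h4 hV.1 hu])
    (by rwa [hinc]) hT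
    (fun k => by
      refine (hstruct.decrements_nonneg_or
        (eigenvalueVec_mem_orderedVectors hE hb hu) k).imp id ?_
      rintro ⟨l, hkl, hgap⟩ ε hε
      simp only [hσ]
      refine eventually_le_infAffine_sub ⟨u, huU⟩ (he k) (hq k) ?_ hε
      rw [hval]
      exact tendsto_squareSum hE hb hu (h4.memLp_system hV.1 hu)
        (fun w hw => h4.memLp_level hw) (fun w hw => orthonormal_of_mem_eigenSystemsLevel hw)
        hK hKU hkl hgap) hε
  -- `increments` undoes the partial sums in `squareSum`, leaving the pairing with each `u_i²`.
  have hinner : ∀ h : Lp ℝ 2 m, ∑ i, fderivWithin ℝ φ (orderedVectors J (α + Vmin))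
      (eigenvalueVec ι E J V) (Pi.single i 1) * increments (fun k => ⟪squareSum ι k u, h⟫) i =
        ⟪spectralGradient ι E (α + Vmin) φ V u, h⟫ := fun h => by
    simp only [squareSum, sum_inner, increments_sum_Iic, spectralGradient, inner_smul_left]
    rfl
  simpa only [hinner, hinc] using hmain

end Superdifferential

end SchrodingerSpectral

theorem theorem5p6 {D : Type*} [MeasurableSpace D] (m : Measure D) [IsFiniteMeasure m]
    {𝕍 : Type*} [NormedAddCommGroup 𝕍] [InnerProductSpace ℝ 𝕍] [CompleteSpace 𝕍]
    (ι : 𝕍 →L[ℝ] Lp ℝ 2 m) (E : 𝕍 →L[ℝ] 𝕍 →L[ℝ] ℝ) (α M : ℝ)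
    (hE : IsCoerciveForm ι E α M)
    (𝒦 : Lp ℝ 2 m → EReal) (θ Vmin : ℝ) (h𝒦 : IsPotentialFunctional 𝒦 θ Vmin)
    (h4 : EigenfunctionsL4 ι E 𝒦 θ (α + Vmin))
    (J : ℕ) (hJ : 1 ≤ J) (φ : (Fin J → ℝ) → ℝ)
    (hφ : ContDiffOn ℝ 1 φ (orderedVectors J (α + Vmin)))
    (hstruct : StructuralCondition (α + Vmin) φ)
    (c : ℝ) (V : Lp ℝ 2 m) (hV : V ∈ admissibleLevel 𝒦 θ c)
    (u : Fin J → 𝕍) (hu : u ∈ eigenSystems ι E J V) :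
    ∃ ξ : Lp ℝ 2 m,
      (ξ =ᵐ[m] fun x =>
        ∑ i, partialDeriv (α + Vmin) φ i (eigenvalueVec ι E J V) * (ι (u i) x) ^ 2) ∧
      (∀ φc : (Fin J → ℝ) → ℝ, IsLevelExtension ι E 𝒦 θ (α + Vmin) c φ φc →
        ξ ∈ frechetSuperdifferential (levelFunctional ι E 𝒦 θ c φc) V) ∧
      ∃ (ω : Lp ℝ 2 m → ℝ) (ρ : ℝ), IsBarrier ω ∧ 0 < ρ ∧
        ∀ W ∈ Metric.ball V ρ ∩ admissibleLevel 𝒦 θ c,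
          spectralFunctional ι E φ W - spectralFunctional ι E φ V - inner ℝ ξ (W - V)
            ≤ ω (W - V) := by
  have hb := h𝒦.lower_bound V hV.1
  have hmem := eigenvalueVec_mem_orderedVectors hE hb hu
  have hinc := increments_sigmaLevel hE h𝒦 h4 hV hu
  refine ⟨spectralGradient ι E (α + Vmin) φ V u,
    coeFn_spectralGradient _ _ _ (h4.memLp_system hV.1 hu), fun φc hφc => ?_, ?_⟩
  -- The margin `1` above `ℓ_J(c)` makes `φ` and `φc` agree on `Λ^J` near `λ(V)`; unique
  -- differentiability of `Λ^J` then identifies their derivatives, also at crossings.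
  · have hnhds : φ =ᶠ[𝓝[orderedVectors J (α + Vmin)] eigenvalueVec ι E J V] φc := by
      have hopen : ∀ᶠ l in 𝓝 (eigenvalueVec ι E J V),
          ∀ i : Fin J, l i < 1 + maxEigenvalue ι E 𝒦 θ J c :=
        eventually_all.2 fun i => ((continuous_apply i).tendsto _).eventually_lt_const
          (by linarith [eigenvalueVec_le_maxEigenvalue hE h𝒦 h4 hV hu i])
      filter_upwards [self_mem_nhdsWithin, hopen.filter_mono nhdsWithin_le_nhds] with l hl hlt
      exact (hφc.2.2 l hl fun i => ⟨hl.1 i, (hlt i).le⟩).symm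
    have hdiff : DifferentiableAt ℝ φc (eigenvalueVec ι E J V) :=
      (hφc.1.differentiable one_ne_zero).differentiableAt
    have hfd : fderivWithin ℝ φ (orderedVectors J (α + Vmin)) (eigenvalueVec ι E J V) =
        fderiv ℝ φc (eigenvalueVec ι E J V) := by
      rw [hnhds.fderivWithin_eq (hnhds.self_of_nhdsWithin hmem),
        hdiff.fderivWithin (uniqueDiffOn_orderedVectors _ hmem)]
    refine mem_frechetSuperdifferential fun ε hε => ?_
    have h := eventually_comp_sigmaLevel_sub_le (f := φc) (S := univ) (T := univ) hE h𝒦 h4 hstruct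
      hV hu (by rw [hfd]; exact hdiff.hasFDerivAt.hasFDerivWithinAt) (fun _ _ => mem_univ _) hε
    filter_upwards [h] with W hW
    have := hW (mem_univ W)
    rwa [← hinc] at this
  -- Here `φ` is differentiable only within `Λ^J`. This suffices on `𝕂[c]`, where the increments of
  -- `σ` are the ordered eigenvalues.
  · have hf := ((hφ.differentiableOn one_ne_zero) _ hmem).hasFDerivWithinAt
    have hW : ∀ W ∈ admissibleLevel 𝒦 θ c, (increments fun k => sigmaLevel ι E 𝒦 θ J c k W) =
        eigenvalueVec ι E J W ∧ eigenvalueVec ι E J W ∈ orderedVectors J (α + Vmin) := by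
      intro W hW
      obtain ⟨w, hw⟩ := nonempty_eigenSystems hE h𝒦 h4 hV.1 hW.1 hu
      exact ⟨increments_sigmaLevel hE h𝒦 h4 hW hw,
        eigenvalueVec_mem_orderedVectors hE (h𝒦.lower_bound W hW.1) hw⟩
    obtain ⟨ω, ρ, hω, hρ, hle⟩ := exists_isBarrier
      (T := {h | V + h ∈ admissibleLevel 𝒦 θ c})
      (e := fun h => spectralFunctional ι E φ (V + h) - spectralFunctional ι E φ V -
        ⟪spectralGradient ι E (α + Vmin) φ V u, h⟫) (fun ε hε => by
        have h := eventually_comp_sigmaLevel_sub_le (f := φ) (T := admissibleLevel 𝒦 θ c) hE h𝒦 h4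
          hstruct hV hu hf (fun W hWT => (hW W hWT).1 ▸ (hW W hWT).2) hε
        obtain ⟨δ, hδ, hball⟩ := Metric.eventually_nhds_iff.1 h
        refine ⟨δ, hδ, fun h hT hh => ?_⟩
        have := hball (y := V + h) (by simpa using hh) hT
        rwa [(hW _ hT).1, add_sub_cancel_left] at this)
    refine ⟨ω, ρ, hω, hρ, fun W hWT => ?_⟩
    have := hle (W - V) (by simpa using hWT.2) (mem_ball_iff_norm.1 hWT.1)
    simpa using this
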